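/- \textbf{Conventions.} Write $\partial=\partial/\partial z$, $\bar\partial=\partial/\partial\bar z$. Let $\Omega\subset\mathbb C$ be open and let $r=(x^1,\dots,x^4):\Omega\to\mathbb R^4$ be a smooth immersion for which $z$ is a conformal parameter, i.e. $\sum_{k=1}^4(\partial x^k)^2=0$. A \emph{Weierstrass representation} of $r$ over $\Omega$ is a tuple of smooth functions $\psi_1,\psi_2,\varphi_1,\varphi_2,U:\Omega\to\mathbb C$ satisfying the Dirac equations $$\partial\psi_2+U\psi_1=0,\quad -\bar\partial\psi_1+\bar U\psi_2=0,\qquad \partial\varphi_2+\bar U\varphi_1=0,\quad -\bar\partial\varphi_1+U\varphi_2=0,$$ and $dx^k=f_k\,dz+\bar f_k\,d\bar z$ on $\Omega$ for $k=1,\dots,4$, where $$f_1=\tfrac i2(\bar\varphi_2\bar\psi_2+\varphi_1\psi_1),\quad f_2=\tfrac12(\bar\varphi_2\bar\psi_2-\varphi_1\psi_1),\quad f_3=\tfrac12(\bar\varphi_2\psi_1+\varphi_1\bar\psi_2),\quad f_4=\tfrac i2(\bar\varphi_2\psi_1-\varphi_1\bar\psi_2).$$ The gauge transformation determined by a function $h$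 is $$(\psi_1,\psi_2,\varphi_1,\varphi_2,U)\mapsto(e^{h}\psi_1,\,e^{\bar h}\psi_2,\,e^{-h}\varphi_1,\,e^{-\bar h}\varphi_2,\,e^{\bar h-h}U).$$ \textbf{Corollary (non-continuable representations).} Let $W\subset\mathbb C$ be open, let $r:W\to\mathbb R^4$ be a smooth immersion for which $z$ is a conformal parameter, and let $V\subsetneq W$ be a non-empty connected open subset which is not a connected component of $W$ (this last condition is automatic when $W$ is connected). Then $r|_V$ has a Weierstrass representation over $V$ that is not the restriction to $V$ of any Weierstrass representation of $r$ over $W$. More precisely, $r$ has a Weierstrass representation over $W$, and there is a holomorphic function $h:V\to\mathbb C$ which is not the restriction to $V$ of a holomorphic function on $W$, such that for every Weierstrass representation of $r$ over $W$, the gauge transformation determined by $h$ of its restriction to $V$ is a Weierstrass representation of $r|_V$ over $V$ that does not extend to a Weierstrass representation of $r$ over $W$. -/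

import Mathlib

open scoped ContDiff ComplexConjugate

noncomputable section

/-- The operator `∂ = ∂/∂z = (∂/∂x - i ∂/∂y) / 2`. -/
def wirtingerD (f : ℂ → ℂ) (z : ℂ) : ℂ :=
  (fderiv ℝ f z 1 - Complex.I * fderiv ℝ f z Complex.I) / 2

/-- The operator `∂̄ = ∂/∂z̄ = (∂/∂x + i ∂/∂y) / 2`. -/
def wirtingerDbar (f : ℂ → ℂ) (z : ℂ) : ℂ :=
  (fderiv ℝ f z 1 + Complex.I * fderiv ℝ f z Complex.I) / 2

/-- `r` restricts on the open set `W` to a smooth immersed surface in Euclidean four-space for which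
`z` is a conformal parameter: the conformality condition is `∑ k, (∂xᵏ/∂z)² = 0`. -/
structure IsConformalImmersionOn (r : ℂ → EuclideanSpace ℝ (Fin 4)) (W : Set ℂ) : Prop where
  smooth : ContDiffOn ℝ ∞ r W
  immersion : ∀ z ∈ W, Function.Injective (fderiv ℝ r z)
  conformal : ∀ z ∈ W, ∑ k : Fin 4, wirtingerD (fun w => ((r w k : ℝ) : ℂ)) z ^ 2 = 0

/-- The data of a Weierstrass representation: two spinors `ψ = (ψ₁, ψ₂)`, `φ = (φ₁, φ₂)` and a
potential `U`. Only the values on the domain under consideration matter. -/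
structure WeierstrassData where
  ψ₁ : ℂ → ℂ
  ψ₂ : ℂ → ℂ
  φ₁ : ℂ → ℂ
  φ₂ : ℂ → ℂ
  U : ℂ → ℂ

namespace WeierstrassData

/-- All components of the data are smooth on `W`. -/
structure SmoothOn (R : WeierstrassData) (W : Set ℂ) : Prop where
  ψ₁ : ContDiffOn ℝ ∞ R.ψ₁ W
  ψ₂ : ContDiffOn ℝ ∞ R.ψ₂ W
  φ₁ : ContDiffOn ℝ ∞ R.φ₁ W
  φ₂ : ContDiffOn ℝ ∞ R.φ₂ W
  U : ContDiffOn ℝ ∞ R.U W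

/-- The Dirac equation `𝒟 ψ = 0` on `W`, where
`𝒟 = [[0, ∂], [-∂̄, 0]] + [[U, 0], [0, Ū]]`. -/
def Dirac (R : WeierstrassData) (W : Set ℂ) : Prop :=
  ∀ z ∈ W, wirtingerD R.ψ₂ z + R.U z * R.ψ₁ z = 0 ∧
    -wirtingerDbar R.ψ₁ z + conj (R.U z) * R.ψ₂ z = 0

/-- The Dirac equation `𝒟^∨ φ = 0` on `W`, where
`𝒟^∨ = [[0, ∂], [-∂̄, 0]] + [[Ū, 0], [0, U]]`. -/
def DualDirac (R : WeierstrassData) (W : Set ℂ) : Prop :=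
  ∀ z ∈ W, wirtingerD R.φ₂ z + conj (R.U z) * R.φ₁ z = 0 ∧
    -wirtingerDbar R.φ₁ z + R.U z * R.φ₂ z = 0

/-- The coefficients `f₁, f₂, f₃, f₄` of the Weierstrass formulas. -/
def coeff (R : WeierstrassData) (z : ℂ) : Fin 4 → ℂ :=
  ![Complex.I / 2 * (conj (R.φ₂ z) * conj (R.ψ₂ z) + R.φ₁ z * R.ψ₁ z),
    1 / 2 * (conj (R.φ₂ z) * conj (R.ψ₂ z) - R.φ₁ z * R.ψ₁ z),
    1 / 2 * (conj (R.φ₂ z) * R.ψ₁ z + R.φ₁ z * conj (R.ψ₂ z)),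
    Complex.I / 2 * (conj (R.φ₂ z) * R.ψ₁ z - R.φ₁ z * conj (R.ψ₂ z))]

/-- The value at the point `z` on the tangent vector `v` of the real one-form
`ηₖ = fₖ dz + f̄ₖ dz̄`. -/
def form (R : WeierstrassData) (k : Fin 4) (z v : ℂ) : ℂ :=
  R.coeff z k * v + conj (R.coeff z k) * conj v

/-- The data `R` is a Weierstrass representation of the surface `r` over `W`: the data is smooth on
`W`, the spinors solve the two Dirac equations with the potential `U`, and the coordinates of
`r` are recovered by integrating the forms `ηₖ`, that is, `dxᵏ = ηₖ` on `W`. -/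
structure Represents (R : WeierstrassData) (r : ℂ → EuclideanSpace ℝ (Fin 4)) (W : Set ℂ) :
    Prop where
  smoothOn : R.SmoothOn W
  dirac : R.Dirac W
  dualDirac : R.DualDirac W
  differential : ∀ z ∈ W, ∀ (k : Fin 4) (v : ℂ),
    ((fderiv ℝ (fun w => r w k) z v : ℝ) : ℂ) = R.form k z v

/-- The gauge transformation of the data determined by `h`. -/
def gauge (h : ℂ → ℂ) (R : WeierstrassData) : WeierstrassData where
  ψ₁ z := Complex.exp (h z) * R.ψ₁ z
  ψ₂ z := Complex.exp (conj (h z)) * R.ψ₂ z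
  φ₁ z := Complex.exp (-h z) * R.φ₁ z
  φ₂ z := Complex.exp (-conj (h z)) * R.φ₂ z
  U z := Complex.exp (conj (h z) - h z) * R.U z

/-- Two data have the same restriction to `V`. -/
structure AgreeOn (R S : WeierstrassData) (V : Set ℂ) : Prop where
  ψ₁ : Set.EqOn R.ψ₁ S.ψ₁ V
  ψ₂ : Set.EqOn R.ψ₂ S.ψ₂ V
  φ₁ : Set.EqOn R.φ₁ S.φ₁ V
  φ₂ : Set.EqOn R.φ₂ S.φ₂ V
  U : Set.EqOn R.U S.U V

/-- The data `S`, given over a subset `V` of `W`, extends to a Weierstrass representation of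
`r` over `W`. -/
def ExtendsTo (S : WeierstrassData) (r : ℂ → EuclideanSpace ℝ (Fin 4)) (V W : Set ℂ) : Prop :=
  ∃ R : WeierstrassData, R.Represents r W ∧ R.AgreeOn S V

end WeierstrassData

/-- The function `h`, given on a subset `V` of `W`, continues analytically to `W`. -/
def ContinuesAnalyticallyTo (h : ℂ → ℂ) (V W : Set ℂ) : Prop :=
  ∃ H : ℂ → ℂ, DifferentiableOn ℂ H W ∧ Set.EqOn H h V

end

/-! ### Wirtinger calculus and the reality of `∂̄∂` on real functions. -/

section Wirtinger

variable {f g : ℂ → ℂ} {z : ℂ} {W : Set ℂ}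

/-! Since `V` is connected and is not a component of `W`, some point `p` of `W` lies in the closure
of `V` but not in `V`. The holomorphic function is `h = 1 / (z - p)`. Gauging by a holomorphic `h`
preserves representations. If the gauged data extended over `W`, then `e^h` and `e^{-h}` would
extend from `V` to smooth functions `g` and `g'` on `W`, recovered by projecting the extended
spinors onto the old ones, which vanish nowhere as pairs. By continuity `g g' = 1` at `p`; but `(z -
p)² ∂ₓg = -g` on `V` passes to the limit as `g p = 0`. This is `not_extendsTo_gauge_inv`.

The main work is the existence of a representation over an arbitrary open `W`. Conformality says
that a 2 × 2 matrix formed from the `∂xᵏ` is singular, and immersion that it is nonzero; a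
representation amounts to a smooth factorization `u vᵀ` of it with `∂̄v` orthogonal to `v`. The
potential and both Dirac equations then follow because `∂̄∂xᵏ` is real (`frame_potential`,
`exists_represents_of_frame`).

A nowhere vanishing `v` is a trivialization of the row-space line bundle (`exists_smooth_section`).
A combination of the two rows, with coefficient chosen by Sard's theorem, has only nondegenerate
zeros; these are divided out by a smooth function with the same local zeros, a locally finite
product in the manner of Weierstrass (`exists_function_with_zeros`).

Orthogonality is reached by rescaling `v` to `e^h v`, with a new `h`, where `∂̄h` is prescribed. The
`∂̄` equation is solved on `W` by cutting the right side into small pieces, taking Cauchy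
transforms, and subtracting Runge approximants to make the sum converge (`exists_wirtingerDbar_eq`).
Both constructions rest on the regions provided by `exists_isFarFrom`. -/

theorem wirtingerDbar_congr (h : f =ᶠ[nhds z] g) : wirtingerDbar f z = wirtingerDbar g z := by
  simp only [wirtingerDbar, h.fderiv_eq]

theorem wirtingerDbar_add (hf : DifferentiableAt ℝ f z) (hg : DifferentiableAt ℝ g z) :
    wirtingerDbar (fun w => f w + g w) z = wirtingerDbar f z + wirtingerDbar g z := by
  simp only [wirtingerDbar, fderiv_fun_add hf hg, add_apply]
  ring

theorem wirtingerD_mul (hf : DifferentiableAt ℝ f z) (hg : DifferentiableAt ℝ g z) :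
    wirtingerD (fun w => f w * g w) z = wirtingerD f z * g z + f z * wirtingerD g z := by
  simp only [wirtingerD, fderiv_fun_mul hf hg, add_apply, smul_apply, smul_eq_mul]
  ring

theorem wirtingerDbar_mul (hf : DifferentiableAt ℝ f z) (hg : DifferentiableAt ℝ g z) :
    wirtingerDbar (fun w => f w * g w) z = wirtingerDbar f z * g z + f z * wirtingerDbar g z := by
  simp only [wirtingerDbar, fderiv_fun_mul hf hg, add_apply, smul_apply, smul_eq_mul]
  ring

theorem wirtingerDbar_const_mul (c : ℂ) (hf : DifferentiableAt ℝ f z) :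
    wirtingerDbar (fun w => c * f w) z = c * wirtingerDbar f z := by
  simp only [wirtingerDbar, fderiv_const_mul hf, smul_apply, smul_eq_mul]
  ring

theorem fderiv_conj_apply (hf : DifferentiableAt ℝ f z) (v : ℂ) :
    fderiv ℝ (fun w => conj (f w)) z v = conj (fderiv ℝ f z v) := by
  have := (Complex.conjCLE.toContinuousLinearMap.hasFDerivAt.comp z hf.hasFDerivAt).fderiv
  have h2 : (fun w => conj (f w)) = (Complex.conjCLE.toContinuousLinearMap ∘ f) := by
    ext w; simp
  rw [h2, this]
  simp

theorem wirtingerD_conj (hf : DifferentiableAt ℝ f z) :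
    wirtingerD (fun w => conj (f w)) z = conj (wirtingerDbar f z) := by
  simp [wirtingerD, wirtingerDbar, fderiv_conj_apply hf, sub_eq_add_neg, map_ofNat]

theorem fderiv_cexp_apply (hf : DifferentiableAt ℝ f z) (v : ℂ) :
    fderiv ℝ (fun w => Complex.exp (f w)) z v = Complex.exp (f z) * fderiv ℝ f z v := by
  rw [hf.hasFDerivAt.cexp.fderiv]
  simp

theorem wirtingerDbar_cexp (hf : DifferentiableAt ℝ f z) :
    wirtingerDbar (fun w => Complex.exp (f w)) z = Complex.exp (f z) * wirtingerDbar f z := by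
  simp only [wirtingerDbar, fderiv_cexp_apply hf]
  ring

theorem wirtingerDbar_eq_zero (hf : DifferentiableAt ℂ f z) : wirtingerDbar f z = 0 := by
  have h : fderiv ℝ f z = (fderiv ℂ f z).restrictScalars ℝ := hf.fderiv_restrictScalars ℝ
  have h2 : fderiv ℂ f z Complex.I = Complex.I * fderiv ℂ f z 1 := by
    conv_lhs => rw [show (Complex.I : ℂ) = Complex.I • (1 : ℂ) by simp, map_smul]
    simp
  simp only [wirtingerDbar, h, ContinuousLinearMap.coe_restrictScalars', h2]
  linear_combination (fderiv ℂ f z 1) / 2 * Complex.I_mul_I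

theorem wirtingerDbar_sum {ι : Type*} (s : Finset ι) {F : ι → ℂ → ℂ}
    (hF : ∀ i ∈ s, DifferentiableAt ℝ (F i) z) :
    wirtingerDbar (fun w => ∑ i ∈ s, F i w) z = ∑ i ∈ s, wirtingerDbar (F i) z := by
  simp only [wirtingerDbar, fderiv_fun_sum hF, sum_apply, Finset.mul_sum]
  rw [← Finset.sum_add_distrib, Finset.sum_div]

theorem ContDiffOn.wirtingerD (hf : ContDiffOn ℝ ∞ f W) (hW : IsOpen W) :
    ContDiffOn ℝ ∞ (wirtingerD f) W := by
  have h := hf.fderiv_of_isOpen (m := ∞) hW (by simp)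
  unfold _root_.wirtingerD
  fun_prop

theorem ContDiffOn.wirtingerDbar (hf : ContDiffOn ℝ ∞ f W) (hW : IsOpen W) :
    ContDiffOn ℝ ∞ (wirtingerDbar f) W := by
  have h := hf.fderiv_of_isOpen (m := ∞) hW (by simp)
  unfold _root_.wirtingerDbar
  fun_prop

theorem ContDiffOn.differentiableAt_real {E : Type*} [NormedAddCommGroup E] [NormedSpace ℝ E]
    {f : ℂ → E} (hf : ContDiffOn ℝ ∞ f W) (hW : IsOpen W) (hz : z ∈ W) :
    DifferentiableAt ℝ f z :=
  (hf.contDiffAt (hW.mem_nhds hz)).differentiableAt (by simp)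

theorem ContDiffOn.complexConj (hf : ContDiffOn ℝ ∞ f W) :
    ContDiffOn ℝ ∞ (fun w => conj (f w)) W :=
  Complex.conjCLE.contDiff.comp_contDiffOn hf

/-- The operator `∂̄∂` maps real functions to real functions. -/
theorem conj_wirtingerDbar_wirtingerD_ofReal {x : ℂ → ℝ} (hx : ContDiffOn ℝ ∞ x W)
    (hW : IsOpen W) (hz : z ∈ W) :
    conj (wirtingerDbar (wirtingerD fun w => (x w : ℂ)) z)
      = wirtingerDbar (wirtingerD fun w => (x w : ℂ)) z := by
  set X : ℂ → ℂ := fun w => (x w : ℂ) with hX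
  have hXs : ContDiffOn ℝ ∞ X W := Complex.ofRealCLM.contDiff.comp_contDiffOn hx
  have hd : DifferentiableAt ℝ (fderiv ℝ X) z :=
    (hXs.fderiv_of_isOpen (m := ∞) hW (by simp)).differentiableAt_real hW hz
  have hsymm : IsSymmSndFDerivAt ℝ X z :=
    (hXs.contDiffAt (hW.mem_nhds hz)).isSymmSndFDerivAt (by simp only [minSmoothness_of_isRCLikeNormedField]; exact ENat.LEInfty.out)
  have hreal : ∀ w ∈ W, ∀ v, fderiv ℝ X w v = ((fderiv ℝ x w v : ℝ) : ℂ) := by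
    intro w hw v
    have := (Complex.ofRealCLM.hasFDerivAt.comp w
      (hx.differentiableAt_real hW hw).hasFDerivAt).fderiv
    have h2 : X = Complex.ofRealCLM ∘ x := by ext; simp [hX]
    rw [h2, this]; simp
  have hconj : ∀ v v', conj (fderiv ℝ (fderiv ℝ X) z v v') = fderiv ℝ (fderiv ℝ X) z v v' := by
    intro v v'
    have e1 : ∀ v', fderiv ℝ (fun w => fderiv ℝ X w v') z v = fderiv ℝ (fderiv ℝ X) z v v' := by
      intro v'
      have := fderiv_clm_apply hd (differentiableAt_const (c := v'))
      rw [this]; simp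
    rw [← e1, ← fderiv_conj_apply (hd.clm_apply (differentiableAt_const _))]
    congr 1
    apply Filter.EventuallyEq.fderiv_eq
    filter_upwards [hW.mem_nhds hz] with w hw
    rw [hreal w hw, Complex.conj_ofReal]
  have hD : ∀ v, fderiv ℝ (wirtingerD X) z v = (fderiv ℝ (fderiv ℝ X) z v 1
      - Complex.I * fderiv ℝ (fderiv ℝ X) z v Complex.I) / 2 := by
    intro v
    have h1 : HasFDerivAt (fun w => fderiv ℝ X w 1) ((fderiv ℝ (fderiv ℝ X) z).flip 1) z := by
      simpa using hd.hasFDerivAt.clm_apply (hasFDerivAt_const (1 : ℂ) z)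
    have h2 : HasFDerivAt (fun w => fderiv ℝ X w Complex.I)
        ((fderiv ℝ (fderiv ℝ X) z).flip Complex.I) z := by
      simpa using hd.hasFDerivAt.clm_apply (hasFDerivAt_const Complex.I z)
    have h3 := ((h1.sub (h2.const_mul Complex.I)).mul_const (2⁻¹ : ℂ)).fderiv
    have h4 : wirtingerD X = fun w => (fderiv ℝ X w 1 - Complex.I * fderiv ℝ X w Complex.I) * 2⁻¹ := by
      ext w; simp [wirtingerD, div_eq_mul_inv]
    rw [h4]
    erw [h3]
    simp [div_eq_mul_inv]
    ring
  -- Symmetry of the second derivative cancels the mixed terms, leaving a quarter of the Laplacian.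
  have hs := hsymm.eq Complex.I 1
  simp only [wirtingerDbar, hD, map_div₀, map_add, map_sub, map_mul, hconj, Complex.conj_I, hs, map_ofNat]
  simp
  ring

end Wirtinger

/-! ### From a rank one factorization to a Weierstrass representation. -/

section Frame

variable {r : ℂ → EuclideanSpace ℝ (Fin 4)} {W : Set ℂ} {z : ℂ}

theorem contDiffOn_coord (hr : ContDiffOn ℝ ∞ r W) (k : Fin 4) :
    ContDiffOn ℝ ∞ (fun w => r w k) W :=
  (EuclideanSpace.proj (𝕜 := ℝ) k).contDiff.comp_contDiffOn hr

theorem fderiv_ofReal_apply {x : ℂ → ℝ} (hx : DifferentiableAt ℝ x z) (v : ℂ) :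
    fderiv ℝ (fun w => (x w : ℂ)) z v = ((fderiv ℝ x z v : ℝ) : ℂ) := by
  have := (Complex.ofRealCLM.hasFDerivAt.comp z hx.hasFDerivAt).fderiv
  have h2 : (fun w => (x w : ℂ)) = Complex.ofRealCLM ∘ x := by ext; simp
  rw [h2, this]; simp

theorem fderiv_eq_wirtingerD {x : ℂ → ℝ} (hx : DifferentiableAt ℝ x z) (v : ℂ) :
    ((fderiv ℝ x z v : ℝ) : ℂ) = wirtingerD (fun w => (x w : ℂ)) z * v
      + conj (wirtingerD (fun w => (x w : ℂ)) z) * conj v := by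
  have hv : fderiv ℝ x z v = v.re * fderiv ℝ x z 1 + v.im * fderiv ℝ x z Complex.I := by
    conv_lhs => rw [show v = v.re • (1 : ℂ) + v.im • Complex.I by simp [Complex.re_add_im]]
    rw [map_add, map_smul, map_smul, smul_eq_mul, smul_eq_mul]
  simp only [wirtingerD, fderiv_ofReal_apply hx, hv]
  generalize fderiv ℝ x z 1 = p
  generalize fderiv ℝ x z Complex.I = q
  apply Complex.ext <;> simp [map_ofNat] <;> ring

theorem exists_wirtingerD_ne_zero (hW : IsOpen W) (hr : IsConformalImmersionOn r W) (hz : z ∈ W) :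
    ∃ k, wirtingerD (fun w => ((r w k : ℝ) : ℂ)) z ≠ 0 := by
  by_contra! h
  have hd := hr.smooth.differentiableAt_real hW hz
  have h0 : fderiv ℝ r z 1 = 0 := by
    ext k
    have h1 := fderiv_eq_wirtingerD ((contDiffOn_coord hr.smooth k).differentiableAt_real hW hz) 1
    rw [h k] at h1
    have h2 := (((EuclideanSpace.proj (𝕜 := ℝ) k).hasFDerivAt).comp z hd.hasFDerivAt).fderiv
    have h3 : (fun w => r w k) = (EuclideanSpace.proj (𝕜 := ℝ) k : _ →L[ℝ] ℝ) ∘ r := by ext; simp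
    rw [h3, h2] at h1
    simpa using h1
  have := hr.immersion z hz (h0.trans (map_zero _).symm)
  exact one_ne_zero this

theorem conj_mul_self_add_ne_zero {a b : ℂ} (hab : a ≠ 0 ∨ b ≠ 0) :
    conj a * a + conj b * b ≠ 0 := by
  intro h
  rw [← Complex.normSq_eq_conj_mul_self, ← Complex.normSq_eq_conj_mul_self] at h
  have h' : Complex.normSq a + Complex.normSq b = 0 := by exact_mod_cast h
  have ha := Complex.normSq_nonneg a
  have hb := Complex.normSq_nonneg b
  rcases hab with hab | hab
  · exact hab (Complex.normSq_eq_zero.1 (by linarith))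
  · exact hab (Complex.normSq_eq_zero.1 (by linarith))

theorem ContDiffOn.div_complex {f g : ℂ → ℂ} (hf : ContDiffOn ℝ ∞ f W) (hg : ContDiffOn ℝ ∞ g W)
    (h0 : ∀ z ∈ W, g z ≠ 0) : ContDiffOn ℝ ∞ (fun z => f z / g z) W := by
  simp only [div_eq_mul_inv]
  exact hf.mul (hg.inv h0)

/-- By `hv`, the vector `v'` is a multiple `q` of `(-v̄₂, v̄₁)`. Expanding `u'` in the orthogonal
basis `u`, `(-ū₂, ū₁)` gives coefficients `s` and `t`, and the two conjugation relations force `s =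
0` and `t = q̄`. Thus a single number governs both derivatives; it becomes the potential. -/
theorem frame_potential {v₁ v₂ u₁ u₂ v₁' v₂' u₁' u₂' : ℂ}
    (hv0 : v₁ ≠ 0 ∨ v₂ ≠ 0) (hu0 : u₁ ≠ 0 ∨ u₂ ≠ 0)
    (hv : conj v₁ * v₁' + conj v₂ * v₂' = 0)
    (h₁ : u₂' * v₂ + u₂ * v₂' = -conj (u₁' * v₁ + u₁ * v₁'))
    (h₂ : u₂' * v₁ + u₂ * v₁' = conj (u₁' * v₂ + u₁ * v₂')) {t : ℂ}
    (ht : t = (u₁ * u₂' - u₂ * u₁') / (conj u₁ * u₁ + conj u₂ * u₂)) :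
    v₁' = -conj t * conj v₂ ∧ v₂' = conj t * conj v₁ ∧
      u₁' = -t * conj u₂ ∧ u₂' = t * conj u₁ := by
  have hV := conj_mul_self_add_ne_zero hv0
  have hU := conj_mul_self_add_ne_zero hu0
  set q : ℂ := (v₁ * v₂' - v₂ * v₁') / (conj v₁ * v₁ + conj v₂ * v₂) with hq
  set s : ℂ := (conj u₁ * u₁' + conj u₂ * u₂') / (conj u₁ * u₁ + conj u₂ * u₂) with hs
  have hqV : q * (conj v₁ * v₁ + conj v₂ * v₂) = v₁ * v₂' - v₂ * v₁' := div_mul_cancel₀ _ hV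
  have ev₁ : v₁' = -q * conj v₂ := by
    apply mul_right_cancel₀ hV
    linear_combination v₁ * hv + conj v₂ * hqV
  have ev₂ : v₂' = q * conj v₁ := by
    apply mul_right_cancel₀ hV
    linear_combination v₂ * hv - conj v₁ * hqV
  have eu₁ : u₁' = s * u₁ - t * conj u₂ := by
    rw [hs, ht]; field_simp; ring
  have eu₂ : u₂' = s * u₂ + t * conj u₁ := by
    rw [hs, ht]; field_simp; ring
  rw [ev₁, ev₂, eu₁, eu₂] at h₁ h₂
  simp only [map_add, map_sub, map_neg, map_mul, Complex.conj_conj] at h₁ h₂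
  have a₁ : s * u₂ + (t - conj q) * conj u₁ = 0 := by
    apply (mul_eq_zero.1 _).resolve_left hV
    linear_combination conj v₂ * h₁ + conj v₁ * h₂
  have a₂ : conj s * conj u₁ - (conj t - q) * u₂ = 0 := by
    apply (mul_eq_zero.1 _).resolve_left hV
    linear_combination v₁ * h₁ - v₂ * h₂
  have a₃ : s * u₁ - (t - conj q) * conj u₂ = 0 := by
    have := congrArg conj a₂
    simpa using this
  have hs0 : s = 0 := by
    apply (mul_eq_zero.1 _).resolve_left hU
    linear_combination conj u₂ * a₁ + conj u₁ * a₃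
  have ht0 : t = conj q := by
    rw [hs0] at a₁ a₃
    have : t - conj q = 0 := by
      apply (mul_eq_zero.1 _).resolve_left hU
      linear_combination u₁ * a₁ - u₂ * a₃
    linear_combination this
  have hq' : conj t = q := by rw [ht0, Complex.conj_conj]
  rw [hq']
  exact ⟨ev₁, ev₂, by rw [eu₁, hs0]; ring, by rw [eu₂, hs0]; ring⟩

/-- A factorization of the rank one matrix of the derivatives `∂xᵏ` whose column factor `v`
satisfies `⟨∂̄v, v⟩ = 0` gives a Weierstrass representation. -/
theorem exists_represents_of_frame (hW : IsOpen W) (hr : ContDiffOn ℝ ∞ r W)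
    {v₁ v₂ u₁ u₂ : ℂ → ℂ} (hv₁ : ContDiffOn ℝ ∞ v₁ W) (hv₂ : ContDiffOn ℝ ∞ v₂ W)
    (hu₁ : ContDiffOn ℝ ∞ u₁ W) (hu₂ : ContDiffOn ℝ ∞ u₂ W)
    (hv0 : ∀ z ∈ W, v₁ z ≠ 0 ∨ v₂ z ≠ 0) (hu0 : ∀ z ∈ W, u₁ z ≠ 0 ∨ u₂ z ≠ 0)
    (hv : ∀ z ∈ W, conj (v₁ z) * wirtingerDbar v₁ z + conj (v₂ z) * wirtingerDbar v₂ z = 0)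
    {f : Fin 4 → ℂ → ℂ} (hf : ∀ k, f k = wirtingerD (fun w => ((r w k : ℝ) : ℂ)))
    (ha : ∀ z ∈ W, u₁ z * v₁ z = f 1 z - Complex.I * f 0 z)
    (hb : ∀ z ∈ W, u₂ z * v₂ z = -f 1 z - Complex.I * f 0 z)
    (hc : ∀ z ∈ W, u₁ z * v₂ z = f 2 z - Complex.I * f 3 z)
    (hd : ∀ z ∈ W, u₂ z * v₁ z = f 2 z + Complex.I * f 3 z) :
    ∃ R : WeierstrassData, R.Represents r W := by
  have hfs : ∀ k, ContDiffOn ℝ ∞ (f k) W := fun k => by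
    rw [hf]
    exact (Complex.ofRealCLM.contDiff.comp_contDiffOn (contDiffOn_coord hr k)).wirtingerD hW
  set U : ℂ → ℂ := fun z => (u₁ z * wirtingerDbar u₂ z - u₂ z * wirtingerDbar u₁ z) /
    (conj (u₁ z) * u₁ z + conj (u₂ z) * u₂ z) with hU
  have hUs : ContDiffOn ℝ ∞ U W := by
    have h1 := hu₁.wirtingerDbar hW
    have h2 := hu₂.wirtingerDbar hW
    have h3 := hu₁.complexConj
    have h4 := hu₂.complexConj
    refine ContDiffOn.div_complex ?_ ?_ fun z hz => conj_mul_self_add_ne_zero (hu0 z hz)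
    · exact (hu₁.mul h2).sub (hu₂.mul h1)
    · exact (h3.mul hu₁).add (h4.mul hu₂)
  have key : ∀ z ∈ W, wirtingerDbar v₁ z = -conj (U z) * conj (v₂ z) ∧
      wirtingerDbar v₂ z = conj (U z) * conj (v₁ z) ∧
      wirtingerDbar u₁ z = -U z * conj (u₂ z) ∧ wirtingerDbar u₂ z = U z * conj (u₁ z) := by
    intro z hz
    have dv₁ := hv₁.differentiableAt_real hW hz
    have dv₂ := hv₂.differentiableAt_real hW hz
    have du₁ := hu₁.differentiableAt_real hW hz
    have du₂ := hu₂.differentiableAt_real hW hz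
    have df := fun k => (hfs k).differentiableAt_real hW hz
    have dreal : ∀ k, conj (wirtingerDbar (f k) z) = wirtingerDbar (f k) z := fun k => by
      rw [hf]; exact conj_wirtingerDbar_wirtingerD_ofReal (contDiffOn_coord hr k) hW hz
    have lin : ∀ (c : ℂ) (k l : Fin 4) (e : ℂ), wirtingerDbar (fun w => e * f k w + c * f l w) z
        = e * wirtingerDbar (f k) z + c * wirtingerDbar (f l) z := fun c k l e => by
      rw [wirtingerDbar_add ((df k).const_mul e) ((df l).const_mul c),
        wirtingerDbar_const_mul _ (df k), wirtingerDbar_const_mul _ (df l)]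
    have prod : ∀ {u v : ℂ → ℂ} (c : ℂ) (k l : Fin 4) (e : ℂ), DifferentiableAt ℝ u z →
        DifferentiableAt ℝ v z → (∀ w ∈ W, u w * v w = e * f k w + c * f l w) →
        wirtingerDbar u z * v z + u z * wirtingerDbar v z
          = e * wirtingerDbar (f k) z + c * wirtingerDbar (f l) z := by
      intro u v c k l e du dv h
      rw [← lin, ← wirtingerDbar_mul du dv]
      exact wirtingerDbar_congr (by filter_upwards [hW.mem_nhds hz] with w hw using h w hw)
    have ea := prod (-Complex.I) 1 0 1 du₁ dv₁ fun w hw => by rw [ha w hw]; ring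
    have eb := prod (-Complex.I) 1 0 (-1) du₂ dv₂ fun w hw => by rw [hb w hw]; ring
    have ec := prod (-Complex.I) 2 3 1 du₁ dv₂ fun w hw => by rw [hc w hw]; ring
    have ed := prod Complex.I 2 3 1 du₂ dv₁ fun w hw => by rw [hd w hw]; ring
    -- The remaining relations express that the `∂̄∂xᵏ` are real: `∂̄` of the diagonal entries, and
    -- of the off-diagonal ones, are conjugate up to sign.
    refine frame_potential (hv0 z hz) (hu0 z hz) (hv z hz) ?_ ?_ rfl
    · rw [ea, eb]; simp [dreal, add_comm]
    · rw [ec, ed]; simp [dreal]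
  -- With this choice `φ̄₂ψ̄₂`, `φ₁ψ₁`, `φ̄₂ψ₁`, `φ₁ψ̄₂` are `u₁v₁`, `u₂v₂`, `u₁v₂`, `u₂v₁`, the
  -- entries of the matrix.
  refine ⟨⟨v₂, fun z => conj (v₁ z), u₂, fun z => conj (u₁ z), U⟩,
    ⟨hv₂, hv₁.complexConj, hu₂, hu₁.complexConj, hUs⟩, ?_, ?_, ?_⟩
  · intro z hz
    obtain ⟨k1, k2, -, -⟩ := key z hz
    simp only [wirtingerD_conj (hv₁.differentiableAt_real hW hz), k1, k2, map_mul, map_neg,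
      Complex.conj_conj]
    constructor <;> ring
  · intro z hz
    obtain ⟨-, -, k3, k4⟩ := key z hz
    simp only [wirtingerD_conj (hu₁.differentiableAt_real hW hz), k3, k4, map_mul, map_neg,
      Complex.conj_conj]
    constructor <;> ring
  · intro z hz k v
    rw [fderiv_eq_wirtingerD ((contDiffOn_coord hr k).differentiableAt_real hW hz)]
    have hk : WeierstrassData.coeff ⟨v₂, fun z => conj (v₁ z), u₂, fun z => conj (u₁ z), U⟩ z k
        = wirtingerD (fun w => ((r w k : ℝ) : ℂ)) z := by
      rw [← hf]
      have hI := Complex.I_mul_I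
      fin_cases k <;> simp [WeierstrassData.coeff]
      · linear_combination Complex.I / 2 * (ha z hz) + Complex.I / 2 * (hb z hz) - f 0 z * hI
      · linear_combination 1 / 2 * (ha z hz) - 1 / 2 * (hb z hz)
      · linear_combination 1 / 2 * (hc z hz) + 1 / 2 * (hd z hz)
      · linear_combination Complex.I / 2 * (hc z hz) - Complex.I / 2 * (hd z hz) - f 3 z * hI
    simp only [WeierstrassData.form, hk]

end Frame

/-! ### Gauge transformations and the obstruction to extension. -/

section Gauge

variable {r : ℂ → EuclideanSpace ℝ (Fin 4)} {V W : Set ℂ} {z : ℂ}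

theorem DifferentiableOn.contDiffOn_real {h : ℂ → ℂ} (hh : DifferentiableOn ℂ h V)
    (hV : IsOpen V) : ContDiffOn ℝ ∞ h V :=
  ContDiffOn.restrict_scalars ℝ (𝕜' := ℂ) (hh.contDiffOn hV)

theorem ContDiffOn.cexp_real {h : ℂ → ℂ} (hh : ContDiffOn ℝ ∞ h V) :
    ContDiffOn ℝ ∞ (fun z => Complex.exp (h z)) V :=
  Complex.contDiff_exp.comp_contDiffOn hh

namespace WeierstrassData

/-- The factors `e^{±h}` are killed by `∂̄` and their conjugates by `∂`, so they pass through the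
Dirac operators, and the phase of `U` matches the two sides. In every coefficient a factor `e^h`
meets a factor `e^{-h}`. -/
theorem Represents.gauge {R : WeierstrassData} (hR : R.Represents r W) (hVW : V ⊆ W)
    (hV : IsOpen V) {h : ℂ → ℂ} (hh : DifferentiableOn ℂ h V) :
    (R.gauge h).Represents r V := by
  have hs := hh.contDiffOn_real hV
  obtain ⟨⟨s₁, s₂, s₃, s₄, s₅⟩, hD, hD', hd⟩ := hR
  replace s₁ := s₁.mono hVW
  replace s₂ := s₂.mono hVW
  replace s₃ := s₃.mono hVW
  replace s₄ := s₄.mono hVW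
  replace s₅ := s₅.mono hVW
  have e₁ := hs.cexp_real
  have e₂ := hs.complexConj.cexp_real
  have e₃ := hs.neg.cexp_real
  have e₄ := hs.complexConj.neg.cexp_real
  have key : ∀ g : ℂ → ℂ, DifferentiableOn ℂ g V → ∀ z ∈ V,
      wirtingerDbar (fun w => Complex.exp (g w)) z = 0 ∧
      wirtingerD (fun w => Complex.exp (conj (g w))) z = 0 := by
    intro g hg z hz
    have hgz : DifferentiableAt ℂ g z := hg.differentiableAt (hV.mem_nhds hz)
    have h1 : wirtingerDbar (fun w => Complex.exp (g w)) z = 0 := wirtingerDbar_eq_zero hgz.cexp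
    refine ⟨h1, ?_⟩
    have h2 := wirtingerD_conj (hgz.cexp.restrictScalars ℝ)
    simpa only [h1, ← Complex.exp_conj, map_zero] using h2
  refine ⟨⟨e₁.mul s₁, e₂.mul s₂, e₃.mul s₃, e₄.mul s₄,
    (hs.complexConj.sub hs).cexp_real.mul s₅⟩, ?_, ?_, ?_⟩
  · intro z hz
    obtain ⟨k₁, k₂⟩ := key h hh z hz
    obtain ⟨d₁, d₂⟩ := hD z (hVW hz)
    simp only [WeierstrassData.gauge]
    rw [wirtingerD_mul (e₂.differentiableAt_real hV hz) (s₂.differentiableAt_real hV hz),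
      wirtingerDbar_mul (e₁.differentiableAt_real hV hz) (s₁.differentiableAt_real hV hz), k₁, k₂]
    have x₁ : Complex.exp (conj (h z) - h z) * Complex.exp (h z) = Complex.exp (conj (h z)) := by
      rw [← Complex.exp_add]; ring_nf
    have x₂ : Complex.exp (h z - conj (h z)) * Complex.exp (conj (h z)) = Complex.exp (h z) := by
      rw [← Complex.exp_add]; ring_nf
    simp only [map_mul, ← Complex.exp_conj, map_sub, Complex.conj_conj]
    constructor
    · linear_combination Complex.exp (conj (h z)) * d₁ + R.U z * R.ψ₁ z * x₁
    · linear_combination Complex.exp (h z) * d₂ + conj (R.U z) * R.ψ₂ z * x₂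
  · intro z hz
    obtain ⟨k₁, k₂⟩ := key (fun w => -h w) hh.neg z hz
    obtain ⟨d₁, d₂⟩ := hD' z (hVW hz)
    simp only [map_neg] at k₂
    simp only [WeierstrassData.gauge]
    rw [wirtingerD_mul (e₄.differentiableAt_real hV hz) (s₄.differentiableAt_real hV hz),
      wirtingerDbar_mul (e₃.differentiableAt_real hV hz) (s₃.differentiableAt_real hV hz), k₁, k₂]
    have x₁ : Complex.exp (h z - conj (h z)) * Complex.exp (-h z) = Complex.exp (-conj (h z)) := by
      rw [← Complex.exp_add]; ring_nf
    have x₂ : Complex.exp (conj (h z) - h z) * Complex.exp (-conj (h z)) = Complex.exp (-h z) := by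
      rw [← Complex.exp_add]; ring_nf
    simp only [map_mul, ← Complex.exp_conj, map_sub, Complex.conj_conj]
    constructor
    · linear_combination Complex.exp (-conj (h z)) * d₁ + conj (R.U z) * R.φ₁ z * x₁
    · linear_combination Complex.exp (-h z) * d₂ + R.U z * R.φ₂ z * x₂
  · intro z hz k v
    rw [hd z (hVW hz) k v]
    have x₁ : ∀ x y, Complex.exp (-h z) * x * (Complex.exp (h z) * y) = x * y := by
      intro x y
      rw [mul_mul_mul_comm, ← Complex.exp_add, neg_add_cancel, Complex.exp_zero, one_mul]
    have hc : (R.gauge h).coeff z k = R.coeff z k := by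
      simp only [coeff, WeierstrassData.gauge, map_mul, ← Complex.exp_conj, map_neg,
        Complex.conj_conj, x₁]
    simp only [form, hc]

/-- Each term of each coefficient contains one component of `ψ` and one of `φ`, so a zero of either
spinor would annihilate all `∂xᵏ`, against immersion. -/
theorem Represents.spinors_ne_zero {R : WeierstrassData} (hR : R.Represents r W) (hW : IsOpen W)
    (hr : IsConformalImmersionOn r W) (hz : z ∈ W) :
    (R.ψ₁ z ≠ 0 ∨ R.ψ₂ z ≠ 0) ∧ (R.φ₁ z ≠ 0 ∨ R.φ₂ z ≠ 0) := by
  by_contra hcon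
  obtain ⟨k, hk⟩ := exists_wirtingerD_ne_zero hW hr hz
  have hx := (contDiffOn_coord hr.smooth k).differentiableAt_real hW hz
  have hc : R.coeff z k = 0 := by
    rw [not_and_or] at hcon
    push Not at hcon
    rcases hcon with ⟨a, b⟩ | ⟨a, b⟩ <;> fin_cases k <;> simp [coeff, a, b]
  apply hk
  simp [wirtingerD, fderiv_ofReal_apply hx, hR.differential z hz, form, hc]

end WeierstrassData

theorem eq_of_mem_closure {f g : ℂ → ℂ} {p : ℂ} (hf : ContinuousAt f p) (hg : ContinuousAt g p)
    (hp : p ∈ closure V) (h : Set.EqOn f g V) : f p = g p :=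
  tendsto_nhds_unique_of_frequently_eq hf hg
    ((mem_closure_iff_frequently.1 hp).mono fun _ hz => h hz)

/-- Otherwise `V` would be relatively clopen in `W`, and being connected it would be a component. -/
theorem exists_mem_closure_notMem (hV : IsOpen V) (hVconn : IsConnected V) (hVW : V ⊆ W)
    (hcomp : ∀ z ∈ V, connectedComponentIn W z ≠ V) : ∃ p ∈ W, p ∈ closure V ∧ p ∉ V := by
  by_contra! hcon
  obtain ⟨z, hz⟩ := hVconn.nonempty
  refine hcomp z hz (Set.Subset.antisymm ?_
    (hVconn.isPreconnected.subset_connectedComponentIn hz hVW))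
  refine isPreconnected_connectedComponentIn.subset_left_of_subset_union hV
    isClosed_closure.isOpen_compl (v := (closure V)ᶜ) ?_ ?_ ⟨z, mem_connectedComponentIn (hVW hz), hz⟩
  · exact Set.disjoint_left.2 fun x hx hx' => hx' (subset_closure hx)
  · intro x hx
    by_cases hxV : x ∈ closure V
    · exact Or.inl (hcon x (connectedComponentIn_subset _ _ hx) hxV)
    · exact Or.inr hxV

theorem not_continuesAnalyticallyTo_inv (hW : IsOpen W) {p : ℂ} (hpW : p ∈ W)
    (hp : p ∈ closure V) (hpV : p ∉ V) :
    ¬ ContinuesAnalyticallyTo (fun z => (z - p)⁻¹) V W := by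
  rintro ⟨H, hH, hHV⟩
  have hc : ContinuousAt H p := (hH.differentiableAt (hW.mem_nhds hpW)).continuousAt
  have := eq_of_mem_closure (f := fun z => H z * (z - p)) (g := fun _ => 1) (by fun_prop)
    continuousAt_const hp fun z hz => by
      have : z - p ≠ 0 := sub_ne_zero.2 fun h => hpV (h ▸ hz)
      simp [hHV hz, this]
  simp at this

/-- Size alone gives no contradiction: `V` may approach `p` through points where the real part of `1
/ (z - p)` is bounded, so that `e^h` and its inverse stay bounded. The derivative of `e^h` does blow
up relative to `e^h`, and this is what smoothness at `p` excludes. -/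
theorem not_extendsTo_gauge_inv (hW : IsOpen W) (hr : IsConformalImmersionOn r W)
    (hV : IsOpen V) (hVW : V ⊆ W) {p : ℂ} (hpW : p ∈ W) (hp : p ∈ closure V) (hpV : p ∉ V)
    {R : WeierstrassData} (hR : R.Represents r W) :
    ¬ (R.gauge fun z => (z - p)⁻¹).ExtendsTo r V W := by
  rintro ⟨S, hS, hSV⟩
  set h : ℂ → ℂ := fun z => (z - p)⁻¹ with hh
  have hne : ∀ z ∈ V, z - p ≠ 0 := fun z hz => sub_ne_zero.2 fun h => hpV (h ▸ hz)
  -- The conjugates are placed so that both terms of the numerator carry the same factor `e^h` on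
  -- `V`.
  set g : ℂ → ℂ := fun z => (S.ψ₁ z * conj (R.ψ₁ z) + conj (S.ψ₂ z) * R.ψ₂ z) /
    (conj (R.ψ₁ z) * R.ψ₁ z + conj (R.ψ₂ z) * R.ψ₂ z) with hg
  set g' : ℂ → ℂ := fun z => (S.φ₁ z * conj (R.φ₁ z) + conj (S.φ₂ z) * R.φ₂ z) /
    (conj (R.φ₁ z) * R.φ₁ z + conj (R.φ₂ z) * R.φ₂ z) with hg'
  have nψ := fun z (hz : z ∈ W) => conj_mul_self_add_ne_zero (hR.spinors_ne_zero hW hr hz).1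
  have nφ := fun z (hz : z ∈ W) => conj_mul_self_add_ne_zero (hR.spinors_ne_zero hW hr hz).2
  obtain ⟨⟨s₁, s₂, s₃, s₄, -⟩, -, -, -⟩ := hR
  obtain ⟨⟨t₁, t₂, t₃, t₄, -⟩, -, -, -⟩ := hS
  have gs : ContDiffOn ℝ ∞ g W :=
    ContDiffOn.div_complex ((t₁.mul s₁.complexConj).add (t₂.complexConj.mul s₂))
      ((s₁.complexConj.mul s₁).add (s₂.complexConj.mul s₂)) nψ
  have gs' : ContDiffOn ℝ ∞ g' W :=
    ContDiffOn.div_complex ((t₃.mul s₃.complexConj).add (t₄.complexConj.mul s₄))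
      ((s₃.complexConj.mul s₃).add (s₄.complexConj.mul s₄)) nφ
  have gV : ∀ z ∈ V, g z = Complex.exp (h z) := by
    intro z hz
    have h1 := hSV.ψ₁ hz
    have h2 := hSV.ψ₂ hz
    simp only [WeierstrassData.gauge] at h1 h2
    simp only [hg, h1, h2]
    rw [div_eq_iff (nψ z (hVW hz))]
    simp only [map_mul, ← Complex.exp_conj, Complex.conj_conj]
    ring
  have gV' : ∀ z ∈ V, g' z = Complex.exp (-h z) := by
    intro z hz
    have h1 := hSV.φ₁ hz
    have h2 := hSV.φ₂ hz
    simp only [WeierstrassData.gauge] at h1 h2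
    simp only [hg', h1, h2]
    rw [div_eq_iff (nφ z (hVW hz))]
    simp only [map_mul, map_neg, ← Complex.exp_conj, Complex.conj_conj]
    ring
  have cg : ContinuousAt g p := (gs.differentiableAt_real hW hpW).continuousAt
  have cg' : ContinuousAt g' p := (gs'.differentiableAt_real hW hpW).continuousAt
  have one : g p * g' p = 1 := eq_of_mem_closure (f := fun z => g z * g' z) (g := fun _ => 1)
    (cg.mul cg') continuousAt_const hp fun z hz => by
      simp [gV z hz, gV' z hz, ← Complex.exp_add]
  have cd : ContinuousAt (fun z => fderiv ℝ g z 1) p := by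
    have := ((gs.fderiv_of_isOpen (m := ∞) hW (by simp)).differentiableAt_real hW hpW).continuousAt
    fun_prop
  -- On `V` one has `∂ₓ e^h = -e^h / (z - p)²`; clearing the denominator leaves an identity between
  -- functions continuous at `p`.
  have := eq_of_mem_closure (f := fun z => fderiv ℝ g z 1 * (z - p) ^ 2) (g := fun z => -g z)
    (by fun_prop) cg.neg hp fun z hz => by
      have e : g =ᶠ[nhds z] fun w => Complex.exp (h w) := by
        filter_upwards [hV.mem_nhds hz] with w hw using gV w hw
      have hd : HasDerivAt (fun w => Complex.exp (h w))
          (Complex.exp (h z) * (-1 / (z - p) ^ 2)) z :=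
        (((hasDerivAt_id z).sub_const p).fun_inv (hne z hz)).cexp
      have := (hd.hasFDerivAt.restrictScalars ℝ).fderiv
      simp only [e.fderiv_eq, this, gV z hz]
      have := hne z hz
      simp
      field_simp
  simp only [sub_self, ne_eq, OfNat.ofNat_ne_zero, not_false_eq_true, zero_pow, mul_zero] at this
  rw [neg_eq_zero.1 this.symm] at one
  simp at one

end Gauge

/-! ### The Cauchy transform inverts `∂̄` on compactly supported functions. -/

section CauchyTransform

open MeasureTheory Set Real

variable {φ : ℂ → ℂ}

/-- This is the polar form `2 e^{-iθ} ∂̄ = ∂ᵣ + (i/r) ∂_θ`, with `L` the differential and `c + si`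
in the role of `e^{iθ}`. -/
theorem clm_wirtinger_polar (L : ℂ →L[ℝ] ℂ) (c s : ℝ) :
    (L 1 + Complex.I * L Complex.I) * (c - s * Complex.I)
      = L (c + s * Complex.I) + Complex.I * L (Complex.I * (c + s * Complex.I)) := by
  have h1 : L (c + s * Complex.I) = c * L 1 + s * L Complex.I := by
    rw [show (c + s * Complex.I : ℂ) = c • (1 : ℂ) + s • Complex.I by simp, map_add, map_smul,
      map_smul]
    simp
  have h2 : L (Complex.I * (c + s * Complex.I)) = c * L Complex.I - s * L 1 := by
    rw [show (Complex.I * (c + s * Complex.I) : ℂ) = c • Complex.I - s • (1 : ℂ) by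
      simp; linear_combination s * Complex.I_mul_I, map_sub, map_smul, map_smul]
    simp
  rw [h1, h2]
  linear_combination (-(s : ℂ)) * L Complex.I * Complex.I_mul_I

/-- In polar coordinates the Jacobian `r` cancels the singularity of `1/t`. The angular derivative
integrates to zero over each circle, and the radial derivative integrates to `-φ 0` along each ray.
-/
theorem integral_inv_mul_wirtingerDbar (hφ : ContDiff ℝ ∞ φ) (hc : HasCompactSupport φ) :
    ∫ t : ℂ, t⁻¹ * wirtingerDbar φ t = -π * φ 0 := by
  obtain ⟨R, hR0, hR⟩ : ∃ R : ℝ, 0 < R ∧ ∀ z, R ≤ ‖z‖ → φ z = 0 ∧ fderiv ℝ φ z = 0 := by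
    obtain ⟨R, hR0, hR⟩ := hc.isCompact.isBounded.exists_pos_norm_lt
    refine ⟨R, hR0, fun z hz => ?_⟩
    have hz' : z ∉ tsupport φ := fun h => (hR z h).not_ge hz
    exact ⟨image_eq_zero_of_notMem_tsupport hz',
      image_eq_zero_of_notMem_tsupport fun h => hz' (tsupport_fderiv_subset ℝ h)⟩
  have hdiff : ∀ z, HasFDerivAt φ (fderiv ℝ φ z) z := fun z =>
    (hφ.differentiable (by simp) z).hasFDerivAt
  have hfc : Continuous (fderiv ℝ φ) := hφ.continuous_fderiv (by simp)
  set e : ℝ → ℂ := fun θ => Real.cos θ + Real.sin θ * Complex.I with he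
  have hec : Continuous e := by fun_prop
  have hen : ∀ θ, ‖e θ‖ = 1 := fun θ => by
    rw [he]; simp only; push_cast; rw [← Complex.exp_mul_I]
    exact Complex.norm_exp_ofReal_mul_I θ
  have hn : ∀ r : ℝ, 0 ≤ r → ∀ θ, ‖(r : ℂ) * e θ‖ = r := fun r hr θ => by
    rw [norm_mul, hen, mul_one, Complex.norm_real, norm_of_nonneg hr]
  set A : ℝ × ℝ → ℂ := fun p => fderiv ℝ φ (p.1 * e p.2) (e p.2) with hA
  set B : ℝ × ℝ → ℂ := fun p => fderiv ℝ φ (p.1 * e p.2) (Complex.I * e p.2) with hB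
  have hAc : Continuous A := by fun_prop
  have hBc : Continuous B := by fun_prop
  have hint : ∀ F : ℝ × ℝ → ℂ, Continuous F → (∀ r θ, R ≤ r → F (r, θ) = 0) →
      IntegrableOn F (Ioi 0 ×ˢ Ioo (-π) π) := by
    intro F hF hF0
    have : IntegrableOn F (Icc 0 R ×ˢ Icc (-π) π) :=
      hF.continuousOn.integrableOn_compact (isCompact_Icc.prod isCompact_Icc)
    refine this.of_forall_sdiff_eq_zero (measurableSet_Ioi.prod measurableSet_Ioo) ?_
    rintro ⟨r, θ⟩ ⟨⟨h1, h2⟩, h3⟩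
    apply hF0
    by_contra! h
    exact h3 ⟨⟨le_of_lt h1, h.le⟩, Ioo_subset_Icc_self h2⟩
  have hAi := hint A hAc fun r θ hr => by
    simp [hA, (hR (r * e θ) (by rw [hn r (hR0.le.trans hr)]; exact hr)).2]
  have hBi := hint B hBc fun r θ hr => by
    simp [hB, (hR (r * e θ) (by rw [hn r (hR0.le.trans hr)]; exact hr)).2]
  have h1 : ∫ t : ℂ, t⁻¹ * wirtingerDbar φ t
      = ∫ p in Ioi (0 : ℝ) ×ˢ Ioo (-π) π, (1 / 2 * A p + Complex.I / 2 * B p) := by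
    rw [← Complex.integral_comp_polarCoord_symm, polarCoord_target]
    refine setIntegral_congr_fun (measurableSet_Ioi.prod measurableSet_Ioo) ?_
    rintro ⟨r, θ⟩ ⟨h1, -⟩
    have hr : (r : ℂ) ≠ 0 := by exact_mod_cast (ne_of_gt h1)
    have hen0 : e θ ≠ 0 := fun h => by simpa [h] using hen θ
    have hinv : (e θ)⁻¹ = Real.cos θ - Real.sin θ * Complex.I := by
      apply inv_eq_of_mul_eq_one_right
      have := Complex.cos_sq_add_sin_sq θ
      simp only [he, Complex.ofReal_cos, Complex.ofReal_sin]
      linear_combination this - Complex.sin θ ^ 2 * Complex.I_mul_I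
    have := clm_wirtinger_polar (fderiv ℝ φ (r * e θ)) (Real.cos θ) (Real.sin θ)
    simp only [Complex.polarCoord_symm_apply, hA, hB]
    change r • (((r : ℂ) * e θ)⁻¹ * wirtingerDbar φ (r * e θ)) = _
    rw [mul_inv, hinv, wirtingerDbar, Complex.real_smul]
    change _ = fderiv ℝ φ (r * e θ) (e θ) + Complex.I * fderiv ℝ φ (r * e θ) (Complex.I * e θ)
      at this
    field_simp
    linear_combination this
  rw [h1, integral_add (hAi.const_mul _) (hBi.const_mul _), integral_const_mul, integral_const_mul]
  have hB0 : ∫ p in Ioi (0 : ℝ) ×ˢ Ioo (-π) π, B p = 0 := by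
    rw [Measure.volume_eq_prod, setIntegral_prod _ hBi]
    refine (setIntegral_congr_fun (g := fun _ => (0 : ℂ)) measurableSet_Ioi ?_).trans (by simp)
    intro r hr
    have hr' : (r : ℂ) ≠ 0 := by exact_mod_cast (ne_of_gt hr)
    simp only
    rw [← integral_Ioc_eq_integral_Ioo, ← intervalIntegral.integral_of_le (by linarith [pi_pos])]
    have hd : ∀ θ ∈ uIcc (-π) π, HasDerivAt (fun θ : ℝ => (r : ℂ)⁻¹ * φ (r * e θ)) (B (r, θ)) θ := by
      intro θ _
      have he' : HasDerivAt e (Complex.I * e θ) θ := by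
        have h1 := (Real.hasDerivAt_cos θ).ofReal_comp
        have h2 := (Real.hasDerivAt_sin θ).ofReal_comp.mul_const Complex.I
        convert! h1.add h2 using 1
        simp only [he]; push_cast
        linear_combination (Complex.sin θ) * Complex.I_mul_I
      have := ((hdiff (r * e θ)).comp_hasDerivAt θ (he'.const_mul (r : ℂ))).const_mul (r : ℂ)⁻¹
      convert! this using 1
      have hs : fderiv ℝ φ (r * e θ) (r * (Complex.I * e θ))
          = r * fderiv ℝ φ (r * e θ) (Complex.I * e θ) := by
        conv_lhs => rw [← Complex.real_smul (x := r) (z := Complex.I * e θ), map_smul,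
          Complex.real_smul]
      rw [hs, inv_mul_cancel_left₀ hr']
    rw [intervalIntegral.integral_eq_sub_of_hasDerivAt hd
      (by apply Continuous.intervalIntegrable; fun_prop)]
    simp [he]
  have hA0 : ∫ p in Ioi (0 : ℝ) ×ˢ Ioo (-π) π, A p = -(2 * π) * φ 0 := by
    rw [Measure.volume_eq_prod, ← setIntegral_prod_swap,
      setIntegral_prod (fun p : ℝ × ℝ => A p.swap) hAi.swap]
    have : ∀ θ ∈ Ioo (-π) π, ∫ r in Ioi (0 : ℝ), A (r, θ) = -φ 0 := by
      intro θ _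
      have hd : ∀ r : ℝ, HasDerivAt (fun r : ℝ => φ (r * e θ)) (A (r, θ)) r := by
        intro r
        have he' : HasDerivAt (fun r : ℝ => (r : ℂ) * e θ) (e θ) r := by
          simpa using (hasDerivAt_id r).ofReal_comp.mul_const (e θ)
        exact (hdiff (r * e θ)).comp_hasDerivAt r he'
      have hz : ∀ r, R ≤ r → φ (r * e θ) = 0 := fun r hr =>
        (hR (r * e θ) (by rw [hn r (hR0.le.trans hr)]; exact hr)).1
      have hi : IntegrableOn (fun r => A (r, θ)) (Ioi 0) := by
        have : IntegrableOn (fun r => A (r, θ)) (Icc 0 R) :=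
          Continuous.integrableOn_Icc (by fun_prop)
        refine this.of_forall_sdiff_eq_zero measurableSet_Ioi fun r hr => ?_
        have : R ≤ r := by
          by_contra! h
          exact hr.2 ⟨le_of_lt hr.1, h.le⟩
        simp [hA, (hR (r * e θ) (by rw [hn r (hR0.le.trans this)]; exact this)).2]
      have := integral_Ioi_of_hasDerivAt_of_tendsto (a := 0) (m := 0)
        (hd 0).continuousAt.continuousWithinAt (fun r _ => hd r) hi
        (tendsto_const_nhds.congr' (by
          filter_upwards [Filter.eventually_ge_atTop R] with r hr using (hz r hr).symm))
      simpa using this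
    simp only [Prod.swap_prod_mk]
    rw [setIntegral_congr_fun measurableSet_Ioo this]
    simp
    ring_nf
    simp [pi_pos.le]
  rw [hA0, hB0]
  ring

/-- The Cauchy transform, the convolution with the fundamental solution `1 / (π z)` of `∂̄`. -/
noncomputable def cauchyTransform (g : ℂ → ℂ) (z : ℂ) : ℂ :=
  ∫ t : ℂ, ((π : ℂ) * t)⁻¹ * g (z - t)

theorem cauchyTransform_eq_integral (g : ℂ → ℂ) (z : ℂ) :
    cauchyTransform g z = ∫ ζ : ℂ, ((π : ℂ) * (z - ζ))⁻¹ * g ζ := by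
  rw [cauchyTransform, ← integral_sub_left_eq_self _ _ z]
  simp

theorem locallyIntegrable_cauchyKernel : LocallyIntegrable fun t : ℂ => ((π : ℂ) * t)⁻¹ := by
  refine locallyIntegrable_of_norm_le_rpow (C := π⁻¹) (α := 1) (by simp) (by simp)
    (Filter.Eventually.of_forall fun t => ?_) (by fun_prop)
  rw [norm_inv, norm_mul, Complex.norm_real, norm_of_nonneg pi_pos.le, mul_inv, rpow_neg_one]

theorem cauchyTransform_eq_convolution (g : ℂ → ℂ) :
    cauchyTransform g = convolution (fun t : ℂ => ((π : ℂ) * t)⁻¹) g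
      (ContinuousLinearMap.mul ℝ ℂ) volume := by
  ext z
  simp [cauchyTransform, convolution_def]

variable {g : ℂ → ℂ}

theorem contDiff_cauchyTransform (hg : ContDiff ℝ ∞ g) (hc : HasCompactSupport g) :
    ContDiff ℝ ∞ (cauchyTransform g) := by
  rw [cauchyTransform_eq_convolution]
  exact hc.contDiff_convolution_right (n := ⊤) _ locallyIntegrable_cauchyKernel hg

/-- Differentiation falls on `g` under the convolution, and the integral formula applies to `t ↦ g
(z - t)`; the reflection supplies the sign that cancels the one in that formula. -/
theorem wirtingerDbar_cauchyTransform (hg : ContDiff ℝ ∞ g) (hc : HasCompactSupport g) (z : ℂ) :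
    wirtingerDbar (cauchyTransform g) z = g z := by
  have hd := (hc.hasFDerivAt_convolution_right (ContinuousLinearMap.mul ℝ ℂ)
    locallyIntegrable_cauchyKernel (hg.of_le (by simp)) z).fderiv
  rw [← cauchyTransform_eq_convolution] at hd
  have happ : ∀ v, fderiv ℝ (cauchyTransform g) z v
      = ∫ t : ℂ, ((π : ℂ) * t)⁻¹ * fderiv ℝ g (z - t) v := by
    intro v
    rw [hd, convolution_precompR_apply _ locallyIntegrable_cauchyKernel (hc.fderiv (𝕜 := ℝ))
      (hg.continuous_fderiv (by simp))]
    simp [convolution_def]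
  have hint : ∀ v, Integrable fun t : ℂ => ((π : ℂ) * t)⁻¹ * fderiv ℝ g (z - t) v := by
    intro v
    have h1 : HasCompactSupport fun w => fderiv ℝ g w v := hc.fderiv_apply (𝕜 := ℝ) v
    have h2 : Continuous fun w => fderiv ℝ g w v := by
      have := hg.continuous_fderiv (by simp)
      fun_prop
    exact h1.convolutionExists_right (ContinuousLinearMap.mul ℝ ℂ)
      locallyIntegrable_cauchyKernel h2 z
  set φ : ℂ → ℂ := fun t => g (z - t) with hφ
  have hφs : ContDiff ℝ ∞ φ := hg.comp (contDiff_const.sub contDiff_id)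
  have hφc : HasCompactSupport φ := hc.comp_homeomorph (Homeomorph.subLeft z)
  have hφd : ∀ t v, fderiv ℝ φ t v = -fderiv ℝ g (z - t) v := by
    intro t v
    have h1 : HasFDerivAt g (fderiv ℝ g (z - t)) (z - t) :=
      (hg.differentiable (by simp) _).hasFDerivAt
    have h2 := (h1.comp t ((hasFDerivAt_id t).const_sub z)).fderiv
    have h3 : φ = g ∘ HSub.hSub z := rfl
    rw [h3, h2]
    simp
  have key := integral_inv_mul_wirtingerDbar hφs hφc
  have hpi : (π : ℂ) ≠ 0 := by exact_mod_cast pi_ne_zero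
  rw [wirtingerDbar, happ, happ, ← integral_const_mul, ← integral_add (hint _)
    ((hint _).const_mul _), ← integral_div]
  have : ∀ t : ℂ, (((π : ℂ) * t)⁻¹ * fderiv ℝ g (z - t) 1
      + Complex.I * (((π : ℂ) * t)⁻¹ * fderiv ℝ g (z - t) Complex.I)) / 2
      = -(π : ℂ)⁻¹ * (t⁻¹ * wirtingerDbar φ t) := by
    intro t
    rw [wirtingerDbar, hφd, hφd, mul_inv]
    ring
  simp_rw [this]
  rw [integral_const_mul, key]
  simp [hφ, hpi]

end CauchyTransform

/-! ### Regions that eventually contain each small neighbourhood as `c` leaves the compact subsets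
of `W`. -/

section FarSets

open Metric Set Filter Topology

variable {W : Set ℂ}

/-- `A` is a region of `W` far from the point `c`, either because it lies in a disc around the origin
which is small compared to `c`, or because it avoids a disc around a boundary point close to `c`. -/
def IsFarFrom (W : Set ℂ) (c : ℂ) (A : Set ℂ) : Prop :=
  A = {z | 4 * ‖z‖ < ‖c‖} ∨ ∃ b ∉ W, A = {z | 4 * ‖c - b‖ < ‖z - b‖}

/-- A point leaving all compact subsets of `W` either escapes to infinity or approaches the
complement. The product of `‖c‖` with the distance to the complement decides which region to use:
outside a large compact set, product at least `1` forces `‖c‖` to be large, and product below `1`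
forces the distance to be small. -/
theorem exists_isFarFrom (hW : IsOpen W) : ∃ A : ℂ → Set ℂ, (∀ c ∈ W, IsFarFrom W c (A c)) ∧
    ∀ z₀ ∈ W, ∃ N ∈ 𝓝 z₀, ∃ K ⊆ W, IsCompact K ∧ ∀ c ∈ W \ K, N ⊆ A c := by
  -- For the whole plane there is no boundary point, and only escape to infinity occurs.
  rcases (Wᶜ).eq_empty_or_nonempty with hne | hne
  · rw [compl_empty_iff] at hne
    refine ⟨fun c => {z | 4 * ‖z‖ < ‖c‖}, fun c _ => Or.inl rfl, fun z₀ _ => ?_⟩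
    refine ⟨ball z₀ 1, ball_mem_nhds _ one_pos, closedBall 0 (4 * (‖z₀‖ + 1)), by simp [hne],
      isCompact_closedBall _ _, fun c hc z hz => ?_⟩
    have h1 := hc.2
    simp only [mem_closedBall, dist_zero_right, not_le] at h1
    have h2 : ‖z‖ ≤ ‖z₀‖ + ‖z - z₀‖ := norm_le_insert' z z₀
    rw [mem_ball, dist_eq_norm] at hz
    simp only [mem_ofPred_eq]
    linarith
  have hcl : IsClosed Wᶜ := hW.isClosed_compl
  have hpos : ∀ c ∈ W, 0 < infDist c Wᶜ := fun c hc =>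
    (hcl.notMem_iff_infDist_pos hne).1 fun h => h hc
  choose b hb hbd using hcl.exists_infDist_eq_dist hne
  refine ⟨fun c => if 1 ≤ ‖c‖ * infDist c Wᶜ then {z | 4 * ‖z‖ < ‖c‖}
    else {z | 4 * ‖c - b c‖ < ‖z - b c‖}, fun c _ => ?_, fun z₀ hz₀ => ?_⟩
  · by_cases h : 1 ≤ ‖c‖ * infDist c Wᶜ
    · exact Or.inl (if_pos h)
    · exact Or.inr ⟨b c, hb c, if_neg h⟩
  set δ := infDist z₀ Wᶜ with hδ
  have hδ0 : 0 < δ := hpos z₀ hz₀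
  -- The first summand puts the neighbourhood of `z₀` in the disc around the origin when `‖c‖ > R`;
  -- the second turns `‖c‖ > R` and a product below `1` into distance below `δ / 8`.
  set R := 4 * (‖z₀‖ + δ) + 8 / δ with hR
  have h8 : 0 < 8 / δ := by positivity
  have hR1 : 4 * (‖z₀‖ + δ) ≤ R := by linarith
  have hR2 : 8 / δ ≤ R := by linarith [norm_nonneg z₀]
  have hR0 : 0 < R := h8.trans_le hR2
  refine ⟨ball z₀ (δ / 2), ball_mem_nhds _ (by positivity),
    closedBall 0 R ∩ {c | min (δ / 8) (1 / R) ≤ infDist c Wᶜ}, ?_, ?_, ?_⟩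
  · rintro c ⟨-, hc⟩
    by_contra hcW
    have : infDist c Wᶜ = 0 := infDist_zero_of_mem hcW
    rw [mem_ofPred_eq, this] at hc
    have : 0 < min (δ / 8) (1 / R) := by positivity
    linarith
  · exact (isCompact_closedBall _ _).inter_right
      (isClosed_le continuous_const (continuous_infDist_pt _))
  · rintro c ⟨hcW, hcK⟩ z hz
    have hd0 := hpos c hcW
    rw [mem_ball, dist_eq_norm] at hz
    have hcK' : ‖c‖ ≤ R → infDist c Wᶜ < min (δ / 8) (1 / R) := fun h => by
      by_contra! h'
      exact hcK ⟨by simpa using h, h'⟩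
    beta_reduce
    split_ifs with h
    · have hcR : R < ‖c‖ := by
        by_contra! hle
        have h1 := (hcK' hle).trans_le (min_le_right _ _)
        have h2 : ‖c‖ * infDist c Wᶜ ≤ R * infDist c Wᶜ := by gcongr
        have h3 : R * infDist c Wᶜ < R * (1 / R) := by gcongr
        rw [mul_one_div_cancel hR0.ne'] at h3
        linarith
      have h2 : ‖z‖ ≤ ‖z₀‖ + ‖z - z₀‖ := norm_le_insert' z z₀
      simp only [mem_ofPred_eq]
      linarith
    · push Not at h
      have hdδ : infDist c Wᶜ < δ / 8 := by
        by_cases hle : ‖c‖ ≤ R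
        · exact (hcK' hle).trans_le (min_le_left _ _)
        · push Not at hle
          have h1 : 8 / δ * infDist c Wᶜ < 1 :=
            lt_of_le_of_lt (by gcongr; linarith) h
          rw [div_mul_eq_mul_div, div_lt_one hδ0] at h1
          linarith
      have h1 : δ ≤ ‖z₀ - b c‖ := by
        rw [← dist_eq_norm]; exact infDist_le_dist_of_mem (hb c)
      have h2 : ‖z₀ - b c‖ ≤ ‖z - b c‖ + ‖z - z₀‖ := by
        rw [show z₀ - b c = (z - b c) - (z - z₀) by ring]; exact norm_sub_le _ _
      have h3 : ‖c - b c‖ = infDist c Wᶜ := by rw [hbd, dist_eq_norm]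
      simp only [mem_ofPred_eq, h3]
      linarith

/-- A family of points which is locally finite in `W` meets each compact subset of `W` in finitely many
members. -/
theorem finite_setOf_mem_compact {ι : Type*} {c : ι → ℂ}
    (hc : ∀ z ∈ W, ∃ N ∈ 𝓝 z, {i | c i ∈ N}.Finite) {K : Set ℂ} (hK : IsCompact K) (hKW : K ⊆ W) :
    {i | c i ∈ K}.Finite := by
  choose! N hN hfin using hc
  obtain ⟨t, ht, hKt⟩ := hK.elim_nhds_subcover N fun z hz => hN z (hKW hz)
  refine (t.finite_toSet.biUnion fun z hz => hfin z (hKW (ht z hz))).subset fun i hi => ?_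
  obtain ⟨z, hz, hzi⟩ := mem_iUnion₂.1 (hKt hi)
  exact mem_iUnion₂.2 ⟨z, hz, hzi⟩

theorem exists_isFarFrom_family (hW : IsOpen W) {ι : Type*} {c : ι → ℂ} (hcW : ∀ i, c i ∈ W)
    (hc : ∀ z ∈ W, ∃ N ∈ 𝓝 z, {i | c i ∈ N}.Finite) :
    ∃ A : ι → Set ℂ, (∀ i, IsFarFrom W (c i) (A i)) ∧
      ∀ z ∈ W, ∃ N ∈ 𝓝 z, {i | ¬ N ⊆ A i}.Finite := by
  obtain ⟨A, hA, hA'⟩ := exists_isFarFrom hW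
  refine ⟨fun i => A (c i), fun i => hA _ (hcW i), fun z hz => ?_⟩
  obtain ⟨N, hN, K, hKW, hK, h⟩ := hA' z hz
  refine ⟨N, hN, (finite_setOf_mem_compact hc hK hKW).subset fun i hi => ?_⟩
  by_contra hiK
  exact hi (h _ ⟨hcW i, hiK⟩)

end FarSets

/-! ### Runge approximation of Cauchy transforms on far regions. -/

section Approximation

open MeasureTheory Metric Set

variable {W : Set ℂ} {g : ℂ → ℂ} {c : ℂ} {ρ : ℝ}

theorem integrable_mul_of_continuousOn (hg : Continuous g)
    (hs : Function.support g ⊆ closedBall c ρ) {k : ℂ → ℂ}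
    (hk : ContinuousOn k (closedBall c ρ)) : Integrable fun ζ => k ζ * g ζ := by
  have : IntegrableOn (fun ζ => k ζ * g ζ) (closedBall c ρ) :=
    (hk.mul hg.continuousOn).integrableOn_compact (isCompact_closedBall _ _)
  rwa [integrableOn_iff_integrable_of_support_subset] at this
  exact (Function.support_mul_subset_right _ _).trans hs

/-- If the Cauchy kernel is split into a kernel `Q` and the remainder `w ^ N / (π (z - ζ))`, then the
Cauchy transform is approximated by the integral against `Q`. -/
theorem norm_cauchyTransform_sub_le (hg : Continuous g)
    (hs : Function.support g ⊆ closedBall c ρ) {z : ℂ} {m : ℝ} (hm : 0 < m)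
    {w Q : ℂ → ℂ} {N : ℕ} (hQ : ContinuousOn Q (closedBall c ρ))
    (hw : ∀ ζ ∈ closedBall c ρ, ‖w ζ‖ ≤ 1 / 2) (hd : ∀ ζ ∈ closedBall c ρ, m ≤ ‖z - ζ‖)
    (heq : ∀ ζ ∈ closedBall c ρ, ((Real.pi : ℂ) * (z - ζ))⁻¹ - Q ζ
      = w ζ ^ N * ((Real.pi : ℂ) * (z - ζ))⁻¹) :
    ‖cauchyTransform g z - ∫ ζ, Q ζ * g ζ‖ ≤ (1 / 2) ^ N * (m⁻¹ * ∫ ζ, ‖g ζ‖) := by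
  have hpi : (Real.pi : ℂ) ≠ 0 := by exact_mod_cast Real.pi_ne_zero
  have hgi : Integrable g := by
    simpa using integrable_mul_of_continuousOn hg hs (k := fun _ => 1) continuousOn_const
  have hci : Integrable fun ζ => ((Real.pi : ℂ) * (z - ζ))⁻¹ * g ζ := by
    refine integrable_mul_of_continuousOn hg hs (ContinuousOn.inv₀ (by fun_prop) fun ζ hζ => ?_)
    refine mul_ne_zero hpi fun h => ?_
    have := hd ζ hζ
    rw [h, norm_zero] at this
    linarith
  rw [cauchyTransform_eq_integral, ← integral_sub hci (integrable_mul_of_continuousOn hg hs hQ),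
    ← mul_assoc, ← integral_const_mul]
  refine norm_integral_le_of_norm_le (hgi.norm.const_mul _) (Filter.Eventually.of_forall fun ζ => ?_)
  by_cases hζ : ζ ∈ closedBall c ρ
  · rw [← sub_mul, heq ζ hζ, norm_mul, norm_mul, norm_pow]
    have h1 := hw ζ hζ
    have h2 : ‖((Real.pi : ℂ) * (z - ζ))⁻¹‖ ≤ m⁻¹ := by
      rw [norm_inv]
      refine inv_anti₀ hm ((hd ζ hζ).trans ?_)
      rw [norm_mul, Complex.norm_real, Real.norm_of_nonneg Real.pi_pos.le]
      exact le_mul_of_one_le_left (norm_nonneg _) (by linarith [Real.pi_gt_three])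
    gcongr
  · have : g ζ = 0 := by
      by_contra h
      exact hζ (hs h)
    simp [this]

theorem exists_half_pow_mul_le (C : ℝ) {ε : ℝ} (hε : 0 < ε) : ∃ N : ℕ, (1 / 2 : ℝ) ^ N * C ≤ ε := by
  have h := (tendsto_pow_atTop_nhds_zero_of_lt_one (r := (1 / 2 : ℝ)) (by norm_num)
    (by norm_num)).mul_const C
  rw [zero_mul] at h
  exact (h.eventually (ge_mem_nhds hε)).exists

/-- The Cauchy kernel is expanded in a geometric series, in powers of `z / ζ` on the disc around the
origin and of `(ζ - b) / (z - b)` away from `b`. The ratio is at most `1/2`, so a partial sum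
suffices; it is a polynomial in `z`, or rational with its only pole at `b ∉ W`. -/
theorem IsFarFrom.exists_approx {A : Set ℂ} (hA : IsFarFrom W c A) (hg : Continuous g)
    (hρ : 0 < ρ) (hρW : closedBall c ρ ⊆ W) (hρc : c ≠ 0 → ρ ≤ ‖c‖ / 2)
    (hs : Function.support g ⊆ closedBall c ρ) {ε : ℝ} (hε : 0 < ε) :
    ∃ P : ℂ → ℂ, DifferentiableOn ℂ P W ∧ ∀ z ∈ A, ‖cauchyTransform g z - P z‖ ≤ ε := by
  have hpi : (Real.pi : ℂ) ≠ 0 := by exact_mod_cast Real.pi_ne_zero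
  rcases hA with rfl | ⟨b, hb, rfl⟩
  -- For `c = 0` the region is empty.
  · rcases eq_or_ne c 0 with rfl | hc
    · refine ⟨0, differentiableOn_const 0, fun z hz => ?_⟩
      rw [mem_ofPred_eq, norm_zero] at hz
      linarith [norm_nonneg z]
    have hc0 : 0 < ‖c‖ := norm_pos_iff.2 hc
    have hζc : ∀ ζ ∈ closedBall c ρ, ‖c‖ / 2 ≤ ‖ζ‖ := by
      intro ζ hζ
      rw [mem_closedBall, dist_eq_norm] at hζ
      have := norm_sub_norm_le c ζ
      rw [norm_sub_rev] at this
      linarith [hρc hc]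
    have hζ0 : ∀ ζ ∈ closedBall c ρ, ζ ≠ 0 := fun ζ hζ => norm_pos_iff.1 (by linarith [hζc ζ hζ])
    obtain ⟨N, hN⟩ := exists_half_pow_mul_le ((‖c‖ / 4)⁻¹ * ∫ ζ, ‖g ζ‖) hε
    have hk : ∀ n : ℕ, ContinuousOn (fun ζ : ℂ => -((Real.pi : ℂ)⁻¹ * (ζ ^ (n + 1))⁻¹))
        (closedBall c ρ) := fun n =>
      (continuousOn_const.mul ((continuousOn_pow _).inv₀ fun ζ hζ => pow_ne_zero _ (hζ0 ζ hζ))).neg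
    refine ⟨fun z => ∑ n ∈ Finset.range N,
      (∫ ζ, -((Real.pi : ℂ)⁻¹ * (ζ ^ (n + 1))⁻¹) * g ζ) * z ^ n, by fun_prop, fun z hz => ?_⟩
    rw [mem_ofPred_eq] at hz
    have hsum : ∑ n ∈ Finset.range N, (∫ ζ, -((Real.pi : ℂ)⁻¹ * (ζ ^ (n + 1))⁻¹) * g ζ) * z ^ n
        = ∫ ζ, (∑ n ∈ Finset.range N, -((Real.pi : ℂ)⁻¹ * (ζ ^ (n + 1))⁻¹) * z ^ n) * g ζ := by
      simp_rw [Finset.sum_mul]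
      rw [integral_finsetSum]
      · refine Finset.sum_congr rfl fun n _ => ?_
        rw [← integral_mul_const]
        exact integral_congr_ae (Filter.Eventually.of_forall fun ζ => by ring)
      · exact fun n _ => integrable_mul_of_continuousOn hg hs ((hk n).mul continuousOn_const)
    beta_reduce
    rw [hsum]
    have hd : ∀ ζ ∈ closedBall c ρ, ‖c‖ / 4 ≤ ‖z - ζ‖ := by
      intro ζ hζ
      have h1 := hζc ζ hζ
      have h2 := norm_sub_norm_le ζ z
      rw [norm_sub_rev] at h2
      linarith
    refine (norm_cauchyTransform_sub_le hg hs (m := ‖c‖ / 4) (by positivity)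
      (w := fun ζ => z / ζ) (N := N) ?_ ?_ hd ?_).trans hN
    · exact continuousOn_finsetSum _ fun n _ => (hk n).mul continuousOn_const
    · intro ζ hζ
      have := hζc ζ hζ
      rw [norm_div, div_le_iff₀ (by linarith)]
      linarith
    · intro ζ hζ
      have h0 := hζ0 ζ hζ
      have h1 : z - ζ ≠ 0 := norm_pos_iff.1 (by linarith [hd ζ hζ])
      have hgeo := geom_sum_mul_neg (z / ζ) N
      have : ∑ n ∈ Finset.range N, -((Real.pi : ℂ)⁻¹ * (ζ ^ (n + 1))⁻¹) * z ^ n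
          = -((Real.pi : ℂ)⁻¹ * ζ⁻¹) * ∑ n ∈ Finset.range N, (z / ζ) ^ n := by
        rw [Finset.mul_sum]
        refine Finset.sum_congr rfl fun n _ => ?_
        rw [div_pow, pow_succ]; field_simp
      rw [this]
      have h2 : ζ - z ≠ 0 := by rw [← neg_sub]; exact neg_ne_zero.2 h1
      have h3 : (1 : ℂ) - z / ζ = -(z - ζ) / ζ := by field_simp; ring
      rw [h3] at hgeo
      rw [mul_inv]
      apply mul_right_cancel₀ (mul_ne_zero hpi h1)
      field_simp at hgeo ⊢
      linear_combination -hgeo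
  · set δ := ‖c - b‖ with hδ
    -- The closed disc lies in `W` while `b` does not.
    have hcb : ρ ≤ δ := by
      by_contra! h
      apply hb (hρW _)
      rw [mem_closedBall, dist_eq_norm, norm_sub_rev]
      exact h.le
    have hδ0 : 0 < δ := hρ.trans_le hcb
    have hζb : ∀ ζ ∈ closedBall c ρ, ‖ζ - b‖ ≤ 2 * δ := by
      intro ζ hζ
      rw [mem_closedBall, dist_eq_norm] at hζ
      have : ‖ζ - b‖ ≤ ‖ζ - c‖ + ‖c - b‖ := norm_sub_le_norm_sub_add_norm_sub _ _ _
      linarith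
    obtain ⟨N, hN⟩ := exists_half_pow_mul_le ((2 * δ)⁻¹ * ∫ ζ, ‖g ζ‖) hε
    have hk : ∀ n : ℕ, ContinuousOn (fun ζ : ℂ => (Real.pi : ℂ)⁻¹ * (ζ - b) ^ n)
        (closedBall c ρ) := fun n => by fun_prop
    refine ⟨fun z => ∑ n ∈ Finset.range N,
      (∫ ζ, ((Real.pi : ℂ)⁻¹ * (ζ - b) ^ n) * g ζ) * ((z - b) ^ (n + 1))⁻¹, ?_, fun z hz => ?_⟩
    · refine DifferentiableOn.fun_sum fun n _ => (differentiableOn_const _).mul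
        (DifferentiableOn.inv (by fun_prop) fun z hz => pow_ne_zero _ (sub_ne_zero.2 ?_))
      rintro rfl
      exact hb hz
    rw [mem_ofPred_eq] at hz
    have hzb : z - b ≠ 0 := norm_pos_iff.1 (by linarith)
    have hsum : ∑ n ∈ Finset.range N,
          (∫ ζ, ((Real.pi : ℂ)⁻¹ * (ζ - b) ^ n) * g ζ) * ((z - b) ^ (n + 1))⁻¹
        = ∫ ζ, (∑ n ∈ Finset.range N,
          ((Real.pi : ℂ)⁻¹ * (ζ - b) ^ n) * ((z - b) ^ (n + 1))⁻¹) * g ζ := by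
      simp_rw [Finset.sum_mul]
      rw [integral_finsetSum]
      · refine Finset.sum_congr rfl fun n _ => ?_
        rw [← integral_mul_const]
        exact integral_congr_ae (Filter.Eventually.of_forall fun ζ => by ring)
      · exact fun n _ => integrable_mul_of_continuousOn hg hs ((hk n).mul continuousOn_const)
    beta_reduce
    rw [hsum]
    have hd : ∀ ζ ∈ closedBall c ρ, 2 * δ ≤ ‖z - ζ‖ := by
      intro ζ hζ
      have h1 := hζb ζ hζ
      have h2 := norm_sub_norm_le (z - b) (ζ - b)
      rw [sub_sub_sub_cancel_right] at h2
      linarith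
    refine (norm_cauchyTransform_sub_le hg hs (m := 2 * δ) (by positivity)
      (w := fun ζ => (ζ - b) / (z - b)) (N := N) ?_ ?_ hd ?_).trans hN
    · exact continuousOn_finsetSum _ fun n _ => (hk n).mul continuousOn_const
    · intro ζ hζ
      have := hζb ζ hζ
      rw [norm_div, div_le_iff₀ (by linarith)]
      linarith
    · intro ζ hζ
      have h1 : z - ζ ≠ 0 := norm_pos_iff.1 (by linarith [hd ζ hζ])
      have hgeo := geom_sum_mul_neg ((ζ - b) / (z - b)) N
      have : ∑ n ∈ Finset.range N, ((Real.pi : ℂ)⁻¹ * (ζ - b) ^ n) * ((z - b) ^ (n + 1))⁻¹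
          = ((Real.pi : ℂ)⁻¹ * (z - b)⁻¹) * ∑ n ∈ Finset.range N, ((ζ - b) / (z - b)) ^ n := by
        rw [Finset.mul_sum]
        refine Finset.sum_congr rfl fun n _ => ?_
        rw [div_pow, pow_succ]; field_simp
      rw [this]
      have h3 : (1 : ℂ) - (ζ - b) / (z - b) = (z - ζ) / (z - b) := by field_simp; ring
      rw [h3] at hgeo
      rw [mul_inv]
      apply mul_right_cancel₀ (mul_ne_zero hpi h1)
      field_simp at hgeo ⊢
      linear_combination -hgeo

end Approximation

/-! ### Solving `∂̄h = g` on an open set. -/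

section DbarEquation

open Metric Set Filter Topology

variable {W : Set ℂ} {g : ℂ → ℂ}

/-- A smooth function on `W` is a locally finite sum of smooth functions supported in small discs. -/
theorem exists_locallyFinite_decomposition (hW : IsOpen W) (hg : ContDiffOn ℝ ∞ g W) :
    ∃ (ι : Type) (c : ι → ℂ) (ρ : ι → ℝ) (G : ι → ℂ → ℂ), Countable ι ∧
      (∀ i, 0 < ρ i ∧ closedBall (c i) (ρ i) ⊆ W ∧ (c i ≠ 0 → ρ i ≤ ‖c i‖ / 2)) ∧
      (∀ i, ContDiff ℝ ∞ (G i) ∧ Function.support (G i) ⊆ ball (c i) (ρ i)) ∧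
      (∀ z ∈ W, ∃ N ∈ 𝓝 z, {i | (ball (c i) (ρ i) ∩ N).Nonempty}.Finite) ∧
      ∀ z ∈ W, ∑ᶠ i, G i z = g z := by
  have hbasis : ∀ x : W, (𝓝 x).HasBasis
      (fun ρ : ℝ => 0 < ρ ∧ closedBall (x : ℂ) ρ ⊆ W ∧ ((x : ℂ) ≠ 0 → ρ ≤ ‖(x : ℂ)‖ / 2))
      (ball x) := by
    intro x
    refine nhds_basis_ball.restrict fun ρ hρ => ?_
    obtain ⟨ρ₁, h₁, h₁'⟩ := nhds_basis_closedBall.mem_iff.1 (hW.mem_nhds x.2)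
    rcases eq_or_ne (x : ℂ) 0 with hx | hx
    · exact ⟨min ρ ρ₁, lt_min hρ h₁,
        ⟨(closedBall_subset_closedBall (min_le_right _ _)).trans h₁', fun h => absurd hx h⟩,
        ball_subset_ball (min_le_left _ _)⟩
    · have : 0 < ‖(x : ℂ)‖ := norm_pos_iff.2 hx
      exact ⟨min ρ (min ρ₁ (‖(x : ℂ)‖ / 2)), by positivity,
        ⟨(closedBall_subset_closedBall ((min_le_right _ _).trans (min_le_left _ _))).trans h₁',
          fun _ => (min_le_right _ _).trans (min_le_right _ _)⟩,
        ball_subset_ball (min_le_left _ _)⟩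
  have : LocallyCompactSpace W := hW.locallyCompactSpace
  obtain ⟨ι, c, ρ, hρ, hcov, hfin⟩ :=
    refinement_of_locallyCompact_sigmaCompact_of_nhds_basis hbasis
  have hball : ∀ i, Subtype.val '' ball (c i) (ρ i) = ball (c i : ℂ) (ρ i) := by
    intro i
    ext z
    constructor
    · rintro ⟨x, hx, rfl⟩
      exact hx
    · intro hz
      exact ⟨⟨z, (hρ i).2.1 (ball_subset_closedBall hz)⟩, hz, rfl⟩
  have hcount : Countable ι := countable_univ_iff.1
    (hfin.countable_univ fun i => ⟨c i, mem_ball_self (hρ i).1⟩)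
  have hloc : ∀ z ∈ W, ∃ N ∈ 𝓝 z, {i | (ball (c i : ℂ) (ρ i) ∩ N).Nonempty}.Finite := by
    intro z hz
    obtain ⟨N, hN, hNf⟩ := hfin ⟨z, hz⟩
    refine ⟨Subtype.val '' N, hW.isOpenEmbedding_subtypeVal.image_mem_nhds.2 hN,
      hNf.subset ?_⟩
    rintro i ⟨w, hw, x, hx, rfl⟩
    exact ⟨x, hw, hx⟩
  choose f hfs hf hf01 using fun i =>
    (isOpen_ball (x := (c i : ℂ)) (ε := ρ i)).exists_contDiff_support_eq (n := ⊤)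
  have hf0 : ∀ i z, 0 ≤ f i z := fun i z => (hf01 i ⟨z, rfl⟩).1
  have hfz : ∀ i z, z ∉ ball (c i : ℂ) (ρ i) → f i z = 0 := fun i z hz => by
    rw [← hfs i] at hz
    exact Function.notMem_support.1 hz
  set S : ℂ → ℝ := fun z => ∑ᶠ i, f i z with hS
  have hSloc : ∀ z ∈ W, ∃ N ∈ 𝓝 z, ∃ F : Finset ι, ∀ w ∈ N, ∀ i ∉ F, f i w = 0 := by
    intro z hz
    obtain ⟨N, hN, hNf⟩ := hloc z hz
    refine ⟨N, hN, hNf.toFinset, fun w hw i hi => hfz i w fun h => hi ?_⟩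
    rw [Finite.mem_toFinset]
    exact ⟨w, h, hw⟩
  have hSsum : ∀ (F : Finset ι) w, (∀ i ∉ F, f i w = 0) → S w = ∑ i ∈ F, f i w := by
    intro F w h
    refine finsum_eq_sum_of_support_subset _ fun i hi => ?_
    by_contra hiF
    exact hi (h i hiF)
  have hSs : ContDiffOn ℝ ∞ S W := by
    intro z hz
    obtain ⟨N, hN, F, hF⟩ := hSloc z hz
    refine ContDiffAt.contDiffWithinAt (ContDiffAt.congr_of_eventuallyEq
      (f := fun w => ∑ i ∈ F, f i w) ?_ ?_)
    · exact ContDiffAt.sum fun i _ => (hf i).contDiffAt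
    · filter_upwards [hN] with w hw using hSsum F w (hF w hw)
  have hSpos : ∀ z ∈ W, 0 < S z := by
    intro z hz
    obtain ⟨N, hN, F, hF⟩ := hSloc z hz
    obtain ⟨i, hi⟩ := mem_iUnion.1 (hcov.symm ▸ mem_univ (⟨z, hz⟩ : W))
    have hiz : f i z ≠ 0 := by
      have : z ∈ Function.support (f i) := by rw [hfs]; exact hi
      exact this
    rw [hSsum F z (hF z (mem_of_mem_nhds hN))]
    refine Finset.sum_pos' (fun j _ => hf0 j z) ⟨i, ?_, (hf0 i z).lt_of_ne' hiz⟩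
    by_contra hiF
    exact hiz (hF z (mem_of_mem_nhds hN) i hiF)
  -- Division by the positive sum `S` normalizes the bumps. Each piece extends by zero across the
  -- boundary of `W`, since its closed disc lies in `W`.
  refine ⟨ι, fun i => c i, ρ, fun i z => (f i z : ℂ) * (g z / S z), hcount, hρ, fun i => ⟨?_, ?_⟩,
    hloc, fun z hz => ?_⟩
  · rw [contDiff_iff_contDiffAt]
    intro z
    by_cases hz : z ∈ W
    · have h1 : ContDiffOn ℝ ∞ (fun z => g z / (S z : ℂ)) W :=
        hg.div_complex (Complex.ofRealCLM.contDiff.comp_contDiffOn hSs) fun z hz => by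
          exact_mod_cast (hSpos z hz).ne'
      exact ((Complex.ofRealCLM.contDiff.comp (hf i)).contDiffAt).mul
        (h1.contDiffAt (hW.mem_nhds hz))
    · refine (contDiffAt_const (c := (0 : ℂ))).congr_of_eventuallyEq ?_
      have hz' : z ∈ (closedBall (c i : ℂ) (ρ i))ᶜ := fun h => hz ((hρ i).2.1 h)
      filter_upwards [isClosed_closedBall.isOpen_compl.mem_nhds hz'] with w hw
      rw [hfz i w fun h => hw (ball_subset_closedBall h)]
      simp
  · intro z hz
    by_contra h
    exact hz (by simp [hfz i z h])
  · obtain ⟨N, hN, F, hF⟩ := hSloc z hz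
    have hz0 := hF z (mem_of_mem_nhds hN)
    rw [finsum_eq_sum_of_support_subset (s := F)]
    · have hne : (S z : ℂ) ≠ 0 := by exact_mod_cast (hSpos z hz).ne'
      rw [← Finset.sum_mul, ← Complex.ofReal_sum, ← hSsum F z hz0]
      field_simp
    · intro i hi
      by_contra hiF
      exact hi (by simp [hz0 i hiF])

theorem differentiableAt_of_wirtingerDbar_eq_zero {f : ℂ → ℂ} {z : ℂ}
    (hf : DifferentiableAt ℝ f z) (h : wirtingerDbar f z = 0) : DifferentiableAt ℂ f z := by
  refine differentiableAt_complex_iff_differentiableAt_real.2 ⟨hf, ?_⟩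
  rw [wirtingerDbar, div_eq_zero_iff, or_iff_left two_ne_zero] at h
  rw [smul_eq_mul]
  linear_combination -Complex.I * h + fderiv ℝ f z Complex.I * Complex.I_mul_I

/-- The inhomogeneous Cauchy–Riemann equation is solvable on every open subset of the plane. -/
theorem exists_wirtingerDbar_eq (hW : IsOpen W) (hg : ContDiffOn ℝ ∞ g W) :
    ∃ h : ℂ → ℂ, ContDiffOn ℝ ∞ h W ∧ ∀ z ∈ W, wirtingerDbar h z = g z := by
  obtain ⟨ι, c, ρ, G, hcount, hρ, hG, hloc, hsum⟩ := exists_locallyFinite_decomposition hW hg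
  have hcl : ∀ z ∈ W, ∃ N ∈ 𝓝 z, {i | c i ∈ N}.Finite := fun z hz => by
    obtain ⟨N, hN, hfin⟩ := hloc z hz
    exact ⟨N, hN, hfin.subset fun i hi => ⟨c i, mem_ball_self (hρ i).1, hi⟩⟩
  obtain ⟨A, hA, hAloc⟩ := exists_isFarFrom_family hW
    (fun i => (hρ i).2.1 (mem_closedBall_self (hρ i).1.le)) hcl
  obtain ⟨ε, hε, _, hεs, -⟩ := NNReal.exists_pos_sum_of_countable (ε := 1) one_ne_zero ι
  have hsupp : ∀ i, Function.support (G i) ⊆ closedBall (c i) (ρ i) := fun i =>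
    (hG i).2.trans ball_subset_closedBall
  have hcomp : ∀ i, HasCompactSupport (G i) := fun i =>
    HasCompactSupport.intro (isCompact_closedBall (c i) (ρ i)) fun z hz => by
      by_contra h
      exact hz (hsupp i h)
  choose P hP hPA using fun i => (hA i).exists_approx (hG i).1.continuous (hρ i).1 (hρ i).2.1
    (hρ i).2.2 (hsupp i) (ε := ε i) (by exact_mod_cast hε i)
  -- Subtracting the holomorphic `P i` leaves `∂̄` unchanged on `W` and makes the terms summable on
  -- far regions.
  set D : ι → ℂ → ℂ := fun i z => cauchyTransform (G i) z - P i z with hD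
  have hDs : ∀ i, ContDiffOn ℝ ∞ (D i) W := fun i =>
    (contDiff_cauchyTransform (hG i).1 (hcomp i)).contDiffOn.sub ((hP i).contDiffOn_real hW)
  have hDd : ∀ i, ∀ z ∈ W, wirtingerDbar (D i) z = G i z := by
    intro i z hz
    have h1 := (contDiff_cauchyTransform (hG i).1 (hcomp i)).differentiable (by simp) z
    have h2 : DifferentiableAt ℂ (fun w => -P i w) z :=
      ((hP i).differentiableAt (hW.mem_nhds hz)).neg
    have h3 := wirtingerDbar_add h1 (h2.restrictScalars ℝ)
    rw [wirtingerDbar_eq_zero h2, wirtingerDbar_cauchyTransform (hG i).1 (hcomp i), add_zero] at h3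
    rw [← h3]
    rfl
  have key : ∀ z ∈ W, ∃ N, IsOpen N ∧ z ∈ N ∧ N ⊆ W ∧ ∃ F : Finset ι, ∃ E : ℂ → ℂ,
      DifferentiableOn ℂ E N ∧ (∀ w ∈ N, ∑' i, D i w = ∑ i ∈ F, D i w + E w) ∧
      ∀ w ∈ N, ∀ i ∉ F, G i w = 0 := by
    intro z hz
    obtain ⟨N₁, hN₁, hf₁⟩ := hloc z hz
    obtain ⟨N₂, hN₂, hf₂⟩ := hAloc z hz
    obtain ⟨N, hN, hNo, hzN⟩ := _root_.mem_nhds_iff.1 (inter_mem (inter_mem hN₁ hN₂) (hW.mem_nhds hz))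
    have hNW : N ⊆ W := fun w hw => (hN hw).2
    -- Outside `F` the disc misses `N` and `N` lies in the far region, so the term is holomorphic on
    -- `N` and bounded by `ε i`; the tail is holomorphic by uniform convergence.
    set F := (hf₁.union hf₂).toFinset with hF
    have hG0 : ∀ w ∈ N, ∀ i ∉ F, G i w = 0 := by
      intro w hw i hi
      by_contra h
      refine hi ?_
      rw [hF, Finite.mem_toFinset]
      exact Or.inl ⟨w, (hG i).2 h, (hN hw).1.1⟩
    have hb : ∀ (i : {i // i ∉ F}), ∀ w ∈ N, ‖D i w‖ ≤ ε i := by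
      rintro ⟨i, hi⟩ w hw
      have : N₂ ⊆ A i := by
        by_contra h
        refine hi ?_
        rw [hF, Finite.mem_toFinset]
        exact Or.inr h
      exact hPA i w (this (hN hw).1.2)
    have hεs' : Summable fun i : {i // i ∉ F} => (ε i : ℝ) :=
      (NNReal.summable_coe.2 ⟨_, hεs⟩).comp_injective Subtype.val_injective
    refine ⟨N, hNo, hzN, hNW, F, fun w => ∑' i : {i // i ∉ F}, D i w, ?_, ?_, hG0⟩
    · refine Complex.differentiableOn_tsum_of_summable_norm hεs' (fun i w hw => ?_) hNo hb
      refine (differentiableAt_of_wirtingerDbar_eq_zero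
        ((hDs i).differentiableAt_real hW (hNW hw)) ?_).differentiableWithinAt
      rw [hDd i w (hNW hw), hG0 w hw i i.2]
    · intro w hw
      have : Summable fun i => D i w := by
        rw [← F.summable_compl_iff]
        exact Summable.of_norm_bounded hεs' fun i => hb i w hw
      exact (this.sum_add_tsum_subtype_compl F).symm
  refine ⟨fun z => ∑' i, D i z, fun z hz => ?_, fun z hz => ?_⟩
  · obtain ⟨N, hNo, hzN, hNW, F, E, hE, heq, -⟩ := key z hz
    refine ContDiffAt.contDiffWithinAt (ContDiffAt.congr_of_eventuallyEq
      (f := fun w => ∑ i ∈ F, D i w + E w) ?_ ?_)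
    · exact (ContDiffAt.sum fun i _ => (hDs i).contDiffAt (hW.mem_nhds hz)).add
        ((hE.contDiffOn_real hNo).contDiffAt (hNo.mem_nhds hzN))
    · filter_upwards [hNo.mem_nhds hzN] with w hw using heq w hw
  · obtain ⟨N, hNo, hzN, hNW, F, E, hE, heq, hG0⟩ := key z hz
    have hEz : DifferentiableAt ℂ E z := hE.differentiableAt (hNo.mem_nhds hzN)
    have hDz : ∀ i ∈ F, DifferentiableAt ℝ (D i) z := fun i _ =>
      (hDs i).differentiableAt_real hW hz
    rw [wirtingerDbar_congr (g := fun w => ∑ i ∈ F, D i w + E w)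
      (by filter_upwards [hNo.mem_nhds hzN] with w hw using heq w hw),
      wirtingerDbar_add (DifferentiableAt.fun_sum hDz) (hEz.restrictScalars ℝ),
      wirtingerDbar_sum F hDz, wirtingerDbar_eq_zero hEz, add_zero, ← hsum z hz,
      finsum_eq_sum_of_support_subset (s := F)]
    · exact Finset.sum_congr rfl fun i _ => hDd i z hz
    · intro i hi
      by_contra hiF
      exact hi (hG0 z hzN i hiF)

end DbarEquation

/-! ### Factors with one prescribed nondegenerate zero, equal to `1` on a far region. -/

section Factor

open Metric Set Filter Topology

variable {W A : Set ℂ} {c : ℂ}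

/-- A smooth function which vanishes at `1` only, is `1 - w` near `1` and equal to `1` near `0`. -/
theorem exists_elementary_factor : ∃ E : ℂ → ℂ, ContDiff ℝ ∞ E ∧ (∀ w, E w = 0 → w = 1) ∧
    (∀ w, ‖w‖ < 1 / 4 → E w = 1) ∧ ∀ᶠ w in 𝓝 1, E w = 1 - w := by
  set χ : ContDiffBump (0 : ℂ) := ⟨1 / 4, 1 / 2, by norm_num, by norm_num⟩ with hχ
  -- A zero satisfies `(1 - χ w) w = 1`, hence `‖w‖ ≥ 1`; there `χ` vanishes, so `w = 1`.
  refine ⟨fun w => 1 - (1 - (χ w : ℂ)) * w, ?_, fun w hw => ?_, fun w hw => ?_, ?_⟩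
  · have : ContDiff ℝ ∞ fun w => (χ w : ℂ) := Complex.ofRealCLM.contDiff.comp χ.contDiff
    fun_prop
  · have h0 : 0 ≤ χ w := χ.nonneg
    have h1 : χ w ≤ 1 := χ.le_one
    have hmul : (1 - (χ w : ℂ)) * w = 1 := by linear_combination -hw
    have hn : (1 - χ w) * ‖w‖ = 1 := by
      have := congrArg norm hmul
      rwa [norm_mul, norm_one, ← Complex.ofReal_one, ← Complex.ofReal_sub, Complex.norm_real,
        Real.norm_of_nonneg (by linarith)] at this
    have hw1 : 1 ≤ ‖w‖ := by nlinarith [norm_nonneg w]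
    have : χ w = 0 := χ.zero_of_le_dist (by rw [dist_zero_right]; change (1 / 2 : ℝ) ≤ _; linarith)
    rw [this] at hmul
    simpa using hmul
  · have : χ w = 1 := χ.one_of_mem_closedBall (by
      rw [mem_closedBall_zero_iff]; exact hw.le)
    simp [this]
  · have : ∀ᶠ w : ℂ in 𝓝 1, 1 / 2 < ‖w‖ :=
      continuous_norm.continuousAt.eventually_const_lt (by norm_num)
    filter_upwards [this] with w hw
    have : χ w = 0 := χ.zero_of_le_dist (by rw [dist_zero_right]; exact hw.le)
    simp [this]

/-- The elementary factor is evaluated at `z / c` or at `(c - b) / (z - b)`: each equals `1` only at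
`c` and has norm below `1/4` on the far region. For `c = 0` that region is empty and the identity
function serves. -/
theorem IsFarFrom.exists_linear_factor (hA : IsFarFrom W c A) (hc : c ∈ W) :
    ∃ G n : ℂ → ℂ, ContDiffOn ℝ ∞ G W ∧ (∀ z ∈ W, G z = 0 → z = c) ∧ (∀ z ∈ W ∩ A, G z = 1) ∧
      (∀ᶠ z in 𝓝 c, ContDiffAt ℝ ∞ n z) ∧ n c ≠ 0 ∧ ∀ᶠ z in 𝓝 c, G z = n z * (z - c) := by
  obtain ⟨E, hE, hE0, hE1, hE'⟩ := exists_elementary_factor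
  rcases hA with rfl | ⟨b, hb, rfl⟩
  · rcases eq_or_ne c 0 with rfl | hc0
    · refine ⟨fun z => z, fun _ => 1, contDiffOn_id, fun z _ h => h, ?_,
        Eventually.of_forall fun _ => contDiffAt_const, one_ne_zero, by simp⟩
      rintro z ⟨-, hz⟩
      rw [mem_ofPred_eq, norm_zero] at hz
      linarith [norm_nonneg z]
    have hcn : 0 < ‖c‖ := norm_pos_iff.2 hc0
    refine ⟨fun z => E (z * c⁻¹), fun _ => -c⁻¹, ?_, fun z _ hz => ?_, ?_,
      Eventually.of_forall fun _ => contDiffAt_const, by simpa using hc0, ?_⟩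
    · exact (hE.comp (contDiff_id.mul contDiff_const)).contDiffOn
    · have := hE0 _ hz
      field_simp at this
      exact this
    · rintro z ⟨-, hz⟩
      refine hE1 _ ?_
      rw [mem_ofPred_eq] at hz
      rw [norm_mul, norm_inv, ← div_eq_mul_inv, div_lt_iff₀ hcn]
      linarith
    · have : Tendsto (fun z : ℂ => z * c⁻¹) (𝓝 c) (𝓝 1) := by
        have h : ContinuousAt (fun z : ℂ => z * c⁻¹) c := by fun_prop
        simpa [ContinuousAt, hc0] using h
      filter_upwards [this.eventually hE'] with z hz
      rw [hz]
      field_simp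
      ring
  · have hcb : c - b ≠ 0 := sub_ne_zero.2 fun h => hb (h ▸ hc)
    have hzb : ∀ z ∈ W, z - b ≠ 0 := fun z hz => sub_ne_zero.2 fun h => hb (h ▸ hz)
    have hne : ∀ᶠ z in 𝓝 c, z - b ≠ 0 :=
      ContinuousAt.eventually_ne (g := fun z => z - b) (by fun_prop) hcb
    refine ⟨fun z => E ((c - b) * (z - b)⁻¹), fun z => (z - b)⁻¹, ?_, fun z hz h => ?_, ?_, ?_,
      inv_ne_zero hcb, ?_⟩
    · exact hE.comp_contDiffOn (contDiffOn_const.mul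
        ((contDiffOn_id.sub contDiffOn_const).inv hzb))
    · have := hE0 _ h
      have h1 := hzb z hz
      field_simp at this
      linear_combination -this
    · rintro z ⟨hzW, hz⟩
      refine hE1 _ ?_
      rw [mem_ofPred_eq] at hz
      rw [norm_mul, norm_inv, ← div_eq_mul_inv, div_lt_iff₀ (norm_pos_iff.2 (hzb z hzW))]
      linarith
    · filter_upwards [hne] with z hz using (contDiffAt_id.sub contDiffAt_const).inv hz
    · have hne : ∀ᶠ z in 𝓝 c, z - b ≠ 0 :=
        ContinuousAt.eventually_ne (g := fun z => z - b) (by fun_prop) hcb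
      have : Tendsto (fun z : ℂ => (c - b) * (z - b)⁻¹) (𝓝 c) (𝓝 1) := by
        have h : ContinuousAt (fun z : ℂ => (c - b) * (z - b)⁻¹) c := by fun_prop (disch := exact hcb)
        simpa [ContinuousAt, hcb] using h
      filter_upwards [this.eventually hE', hne] with z hz h1
      rw [hz]
      field_simp
      ring

/-- A factor with local form `n * ℓ` at its zero can be deformed to one with local form `n * q`
if `q` is close to `ℓ`. -/
theorem exists_deformed_factor (hW : IsOpen W) (hc : c ∈ W) {G n ℓ q : ℂ → ℂ}
    (hG : ContDiffOn ℝ ∞ G W) (hG0 : ∀ z ∈ W, G z = 0 → z = c) (hGA : ∀ z ∈ W ∩ A, G z = 1)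
    (hn : ∀ᶠ z in 𝓝 c, ContDiffAt ℝ ∞ n z) (hn0 : n c ≠ 0) (hGn : ∀ᶠ z in 𝓝 c, G z = n z * ℓ z)
    (hℓ : ContDiff ℝ ∞ ℓ) (hℓc : ℓ c = 0) (hq : ∀ᶠ z in 𝓝 c, ContDiffAt ℝ ∞ q z)
    (hqℓ : ∀ᶠ z in 𝓝[≠] c, ‖q z - ℓ z‖ < ‖ℓ z‖) :
    ∃ H : ℂ → ℂ, ContDiffOn ℝ ∞ H W ∧ (∀ z ∈ W, H z = 0 → z = c) ∧ (∀ z ∈ W ∩ A, H z = 1) ∧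
      ∀ᶠ z in 𝓝 c, H z = n z * q z := by
  have hGc : G c = 0 := by rw [hGn.self_of_nhds, hℓc, mul_zero]
  -- This keeps the disc of deformation away from `A`, where `G` is `1`.
  have hG1 : ∀ᶠ z in 𝓝 c, G z ≠ 1 :=
    ((hG.differentiableAt_real hW hc).continuousAt).eventually_ne (by simp [hGc])
  rw [eventually_nhdsWithin_iff] at hqℓ
  have hn0' : ∀ᶠ z in 𝓝 c, n z ≠ 0 := hn.self_of_nhds.continuousAt.eventually_ne hn0
  obtain ⟨ρ, hρ, hball⟩ := Metric.eventually_nhds_iff_ball.1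
    (hGn.and (hG1.and (hqℓ.and (hn0'.and (hn.and (hq.and (hW.mem_nhds hc)))))))
  set χ : ContDiffBump c := ⟨ρ / 4, ρ / 2, by positivity, by linarith⟩ with hχ
  have hχs : ContDiff ℝ ∞ fun z => (χ z : ℂ) := Complex.ofRealCLM.contDiff.comp χ.contDiff
  have hχ0 : ∀ z, ρ / 2 ≤ dist z c → χ z = 0 := fun z hz => χ.zero_of_le_dist hz
  -- Near `c` this is `n (ℓ + χ (q - ℓ))`; as `q - ℓ` is smaller than `ℓ` and `0 ≤ χ ≤ 1`, no new
  -- zero appears.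
  refine ⟨fun z => G z + χ z * (n z * (q z - ℓ z)), fun z hz => ContDiffAt.contDiffWithinAt ?_,
    fun z hz h0 => ?_, fun z hz => ?_, ?_⟩
  · have hGz := hG.contDiffAt (hW.mem_nhds hz)
    rcases lt_or_ge (ρ / 2) (dist z c) with h | h
    · refine hGz.congr_of_eventuallyEq ?_
      have : ∀ᶠ w in 𝓝 z, ρ / 2 < dist w c :=
        Tendsto.eventually_const_lt h (by apply ContinuousAt.tendsto (f := fun w => dist w c); fun_prop)
      filter_upwards [this] with w hw
      simp [hχ0 w hw.le]
    · obtain ⟨-, -, -, -, h5, h6, -⟩ := hball z (by rw [mem_ball]; linarith)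
      exact hGz.add (hχs.contDiffAt.mul (h5.mul (h6.sub hℓ.contDiffAt)))
  · rcases le_or_gt (ρ / 2) (dist z c) with h | h
    · exact hG0 z hz (by simpa [hχ0 z h] using h0)
    · obtain ⟨h1, -, h3, h4, -⟩ := hball z (by rw [mem_ball]; linarith)
      by_contra hzc
      have h3' := h3 hzc
      beta_reduce at h0
      rw [h1] at h0
      have h5 : ℓ z = -((χ z : ℂ) * (q z - ℓ z)) := by
        apply mul_left_cancel₀ h4
        linear_combination h0
      have h6 : ‖ℓ z‖ ≤ ‖q z - ℓ z‖ := by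
        conv_lhs => rw [h5, norm_neg, norm_mul, Complex.norm_real, Real.norm_of_nonneg χ.nonneg]
        exact mul_le_of_le_one_left (norm_nonneg _) χ.le_one
      linarith
  · have : χ z = 0 := by
      apply hχ0
      by_contra! h
      exact (hball z (by rw [mem_ball]; linarith)).2.1 (hGA z hz)
    simp [this, hGA z hz]
  · filter_upwards [hGn, χ.eventuallyEq_one] with z h1 h2
    have h2' : χ z = 1 := h2
    rw [h1, h2']
    push_cast
    ring

theorem fderiv_apply_eq_wirtinger {q : ℂ → ℂ} {z : ℂ} (v : ℂ) :
    fderiv ℝ q z v = wirtingerD q z * v + wirtingerDbar q z * conj v := by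
  have hv : fderiv ℝ q z v = v.re * fderiv ℝ q z 1 + v.im * fderiv ℝ q z Complex.I := by
    conv_lhs => rw [show v = v.re • (1 : ℂ) + v.im • Complex.I by simp [Complex.re_add_im]]
    rw [map_add, map_smul, map_smul, Complex.real_smul, Complex.real_smul]
  rw [hv, wirtingerD, wirtingerDbar]
  have h1 : v = v.re + v.im * Complex.I := (Complex.re_add_im v).symm
  have h2 : conj v = v.re - v.im * Complex.I := by
    apply Complex.ext <;> simp
  rw [h2]
  conv_rhs => rw [h1]
  simp only [Complex.add_re, Complex.ofReal_re, Complex.mul_re, Complex.I_re, mul_zero,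
    Complex.ofReal_im, Complex.I_im, mul_one, sub_self, add_zero, Complex.add_im, Complex.mul_im,
    zero_add]
  linear_combination ((v.im : ℂ) * fderiv ℝ q z Complex.I) * Complex.I_mul_I

/-- The Jacobian determinant is `|∂q|² - |∂̄q|²`. -/
theorem norm_wirtinger_ne {q : ℂ → ℂ} {z : ℂ} (h : (fderiv ℝ q z).det ≠ 0) :
    ‖wirtingerD q z‖ ≠ ‖wirtingerDbar q z‖ := by
  intro heq
  apply h
  have h2 : Complex.normSq (wirtingerD q z) = Complex.normSq (wirtingerDbar q z) := by
    rw [Complex.normSq_eq_norm_sq, Complex.normSq_eq_norm_sq, heq]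
  rw [ContinuousLinearMap.det, ← LinearMap.det_toMatrix Complex.basisOneI, Matrix.det_fin_two]
  simp only [LinearMap.toMatrix_apply, Complex.coe_basisOneI, Complex.coe_basisOneI_repr]
  simp only [wirtingerD, wirtingerDbar, Complex.normSq_div] at h2
  rw [div_left_inj' (by simp)] at h2
  simp only [Complex.normSq_apply] at h2
  simp at h2 ⊢
  linarith

/-- The gap `α - β` absorbs the remainder in the first order expansion of `q`. In the application
`ℓ` is the dominant one of the complex linear and antilinear parts of the differential. -/
theorem eventually_norm_sub_lt_norm {q : ℂ → ℂ} (hq : DifferentiableAt ℝ q c) (hqc : q c = 0)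
    {ℓ : ℂ → ℂ} {α β : ℝ} (hαβ : β < α)
    (hℓ : ∀ z, ‖ℓ z‖ = α * ‖z - c‖) (hℓ' : ∀ z, ‖fderiv ℝ q c (z - c) - ℓ z‖ = β * ‖z - c‖) :
    ∀ᶠ z in 𝓝[≠] c, ‖q z - ℓ z‖ < ‖ℓ z‖ := by
  rw [eventually_nhdsWithin_iff]
  have := hq.hasFDerivAt.isLittleO.def (c := (α - β) / 2) (by linarith)
  filter_upwards [this] with z hz hzc
  rw [hqc, sub_zero] at hz
  have h0 : 0 < ‖z - c‖ := norm_pos_iff.2 (sub_ne_zero.2 hzc)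
  have h1 : ‖q z - ℓ z‖ ≤ ‖q z - fderiv ℝ q c (z - c)‖ + ‖fderiv ℝ q c (z - c) - ℓ z‖ :=
    norm_sub_le_norm_sub_add_norm_sub _ _ _
  rw [hℓ' z] at h1
  rw [hℓ z]
  nlinarith

/-- A nondegenerate zero preserves or reverses orientation according to which Wirtinger derivative
dominates. In the first case the linear factor is deformed to `q`, in the second its complex
conjugate; the coefficient of the dominant part is absorbed into `n`. -/
theorem IsFarFrom.exists_factor (hA : IsFarFrom W c A) (hW : IsOpen W) (hc : c ∈ W) {q : ℂ → ℂ}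
    (hq : ∀ᶠ z in 𝓝 c, ContDiffAt ℝ ∞ q z) (hqc : q c = 0) (hdet : (fderiv ℝ q c).det ≠ 0) :
    ∃ G n : ℂ → ℂ, ContDiffOn ℝ ∞ G W ∧ (∀ z ∈ W, G z = 0 → z = c) ∧ (∀ z ∈ W ∩ A, G z = 1) ∧
      (∀ᶠ z in 𝓝 c, ContDiffAt ℝ ∞ n z) ∧ n c ≠ 0 ∧ ∀ᶠ z in 𝓝 c, G z = n z * q z := by
  obtain ⟨G, n, hG, hG0, hGA, hn, hn0, hGn⟩ := hA.exists_linear_factor hc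
  have hd : DifferentiableAt ℝ q c := hq.self_of_nhds.differentiableAt (by simp)
  rcases lt_or_gt_of_ne (norm_wirtinger_ne hdet) with h | h
  · have h0 : wirtingerDbar q c ≠ 0 := norm_pos_iff.1 ((norm_nonneg _).trans_lt h)
    set m : ℂ → ℂ := fun z => conj (n z) * (wirtingerDbar q c)⁻¹ with hm
    have hms : ∀ᶠ z in 𝓝 c, ContDiffAt ℝ ∞ m z := by
      filter_upwards [hn] with z hz using
        (Complex.conjCLE.contDiff.contDiffAt.comp z hz).mul contDiffAt_const
    have hm0 : m c ≠ 0 := mul_ne_zero (by simpa using hn0) (inv_ne_zero h0)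
    obtain ⟨H, h1, h2, h3, h4⟩ := exists_deformed_factor (A := A) (G := fun z => conj (G z)) (n := m)
      (ℓ := fun z => wirtingerDbar q c * conj (z - c)) hW hc hG.complexConj
      (fun z hz h => hG0 z hz (by simpa using h)) (fun z hz => by simp [hGA z hz]) hms hm0
      (by filter_upwards [hGn] with z hz; rw [hz, hm]; simp; field_simp)
      (contDiff_const.mul (Complex.conjCLE.contDiff.comp (contDiff_id.sub contDiff_const)))
      (by simp) hq
      (eventually_norm_sub_lt_norm hd hqc h (fun z => by rw [norm_mul, RCLike.norm_conj]) fun z => by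
        rw [fderiv_apply_eq_wirtinger, add_sub_cancel_right, norm_mul])
    exact ⟨H, m, h1, h2, h3, hms, hm0, h4⟩
  · have h0 : wirtingerD q c ≠ 0 := norm_pos_iff.1 ((norm_nonneg _).trans_lt h)
    set m : ℂ → ℂ := fun z => n z * (wirtingerD q c)⁻¹ with hm
    have hms : ∀ᶠ z in 𝓝 c, ContDiffAt ℝ ∞ m z := by
      filter_upwards [hn] with z hz using hz.mul contDiffAt_const
    have hm0 : m c ≠ 0 := mul_ne_zero hn0 (inv_ne_zero h0)
    obtain ⟨H, h1, h2, h3, h4⟩ := exists_deformed_factor (A := A) (G := G) (n := m)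
      (ℓ := fun z => wirtingerD q c * (z - c)) hW hc hG hG0 hGA hms hm0
      (by filter_upwards [hGn] with z hz; rw [hz, hm]; field_simp)
      (contDiff_const.mul (contDiff_id.sub contDiff_const)) (by simp) hq
      (eventually_norm_sub_lt_norm hd hqc h (fun z => norm_mul _ _) fun z => by
        rw [fderiv_apply_eq_wirtinger, add_sub_cancel_left, norm_mul, RCLike.norm_conj])
    exact ⟨H, m, h1, h2, h3, hms, hm0, h4⟩

end Factor

/-! ### Triviality of the line bundle spanned by the rows. -/

section GlobalFrame

open MeasureTheory Metric Set Filter Topology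

variable {W : Set ℂ}

/-- Division of a pair of functions by a function with isolated zeros, given local quotients. -/
theorem exists_quotient {s₁ s₂ G : ℂ → ℂ} (hG : ∀ p ∈ W, ∀ᶠ z in 𝓝[≠] p, G z ≠ 0)
    (h : ∀ p ∈ W, ∃ n₁ n₂ : ℂ → ℂ, ContDiffAt ℝ ∞ n₁ p ∧ ContDiffAt ℝ ∞ n₂ p ∧
      (n₁ p ≠ 0 ∨ n₂ p ≠ 0) ∧ ∀ᶠ z in 𝓝 p, s₁ z = G z * n₁ z ∧ s₂ z = G z * n₂ z)
    (hW : IsOpen W) :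
    ∃ v₁ v₂ : ℂ → ℂ, ContDiffOn ℝ ∞ v₁ W ∧ ContDiffOn ℝ ∞ v₂ W ∧
      (∀ z ∈ W, v₁ z ≠ 0 ∨ v₂ z ≠ 0) ∧ ∀ z ∈ W, s₁ z = G z * v₁ z ∧ s₂ z = G z * v₂ z := by
  choose! n₁ n₂ hn₁ hn₂ hne hs using h
  have hz : ∀ z ∈ W, s₁ z = G z * n₁ z z ∧ s₂ z = G z * n₂ z z := fun z hz =>
    (hs z hz).self_of_nhds
  -- Off the isolated zeros of `G` quotients are unique, so the diagonal values `n₁ z z` agree near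
  -- `p` with the single smooth function `n₁ p`.
  have key : ∀ p ∈ W, ∀ᶠ z in 𝓝 p, n₁ z z = n₁ p z ∧ n₂ z z = n₂ p z := by
    intro p hp
    have hGp := hG p hp
    rw [eventually_nhdsWithin_iff] at hGp
    filter_upwards [hGp, hs p hp, hW.mem_nhds hp] with z h1 h2 h3
    by_cases hzp : z = p
    · simp [hzp]
    · have h4 := hz z h3
      exact ⟨mul_left_cancel₀ (h1 hzp) (h4.1.symm.trans h2.1),
        mul_left_cancel₀ (h1 hzp) (h4.2.symm.trans h2.2)⟩
  refine ⟨fun z => n₁ z z, fun z => n₂ z z, fun p hp => ?_, fun p hp => ?_, hne, hz⟩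
  · exact ((hn₁ p hp).congr_of_eventuallyEq ((key p hp).mono fun z h => h.1)).contDiffWithinAt
  · exact ((hn₂ p hp).congr_of_eventuallyEq ((key p hp).mono fun z h => h.2)).contDiffWithinAt

/-- A function on `W` with prescribed simple zeros, modelled on the given local functions. -/
theorem exists_function_with_zeros (hW : IsOpen W) {Z : Set ℂ} (hZW : Z ⊆ W) {q : ℂ → ℂ}
    (hZ : ∀ p ∈ W, ∃ N ∈ 𝓝 p, N ∩ Z ⊆ {p})
    (hq : ∀ p ∈ Z, (∀ᶠ z in 𝓝 p, ContDiffAt ℝ ∞ q z) ∧ q p = 0 ∧ (fderiv ℝ q p).det ≠ 0) :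
    ∃ G : ℂ → ℂ, ContDiffOn ℝ ∞ G W ∧ (∀ z ∈ W, G z = 0 → z ∈ Z) ∧
      ∀ p ∈ Z, ∃ n : ℂ → ℂ, ContDiffAt ℝ ∞ n p ∧ n p ≠ 0 ∧ ∀ᶠ z in 𝓝 p, G z = n z * q z := by
  obtain ⟨A, hA, hAloc⟩ := exists_isFarFrom_family hW (c := fun i : Z => (i : ℂ))
    (fun i => hZW i.2) fun z hz => by
      obtain ⟨N, hN, hNZ⟩ := hZ z hz
      refine ⟨N, hN, Set.Subsingleton.finite fun i hi j hj => Subtype.ext ?_⟩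
      rw [show (i : ℂ) = z from hNZ ⟨hi, i.2⟩, show (j : ℂ) = z from hNZ ⟨hj, j.2⟩]
  choose G n hGs hG0 hGA hns hn0 hGn using fun i : Z =>
    (hA i).exists_factor hW (hZW i.2) (hq i i.2).1 (hq i i.2).2.1 (hq i i.2).2.2
  have hloc : ∀ p ∈ W, ∃ F : Finset Z, (∀ i ∉ F, G i p = 1) ∧
      ∀ᶠ z in 𝓝 p, ∏ᶠ i, G i z = ∏ i ∈ F, G i z := by
    intro p hp
    obtain ⟨N, hN, hfin⟩ := hAloc p hp
    have hone : ∀ z ∈ N, z ∈ W → ∀ i ∉ hfin.toFinset, G i z = 1 := by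
      intro z hzN hzW i hi
      rw [Finite.mem_toFinset] at hi
      exact hGA i z ⟨hzW, not_not.1 hi hzN⟩
    refine ⟨hfin.toFinset, hone p (mem_of_mem_nhds hN) hp, ?_⟩
    filter_upwards [hN, hW.mem_nhds hp] with z hzN hzW
    refine finprod_eq_prod_of_mulSupport_subset _ fun i hi => ?_
    by_contra hiF
    exact hi (hone z hzN hzW i hiF)
  refine ⟨fun z => ∏ᶠ i, G i z, fun p hp => ?_, fun z hz h0 => ?_, fun p hp => ?_⟩
  · obtain ⟨F, -, hF⟩ := hloc p hp
    exact ((contDiffAt_prod fun i _ => (hGs i).contDiffAt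
      (hW.mem_nhds hp)).congr_of_eventuallyEq hF).contDiffWithinAt
  · obtain ⟨F, -, hF⟩ := hloc z hz
    beta_reduce at h0
    rw [hF.self_of_nhds, Finset.prod_eq_zero_iff] at h0
    obtain ⟨i, -, hi⟩ := h0
    rw [hG0 i z hz hi]
    exact i.2
  · classical
    obtain ⟨F, hF1, hF⟩ := hloc p (hZW hp)
    set i₀ : Z := ⟨p, hp⟩ with hi₀
    have hGp : G i₀ p = 0 := by
      rw [(hGn i₀).self_of_nhds, (hq p hp).2.1, mul_zero]
    -- Only the factor belonging to `p` vanishes at `p`; the others are absorbed into the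
    -- multiplier.
    have hall : ∀ᶠ z in 𝓝 p, ∏ᶠ i, G i z = G i₀ z * ∏ i ∈ F.erase i₀, G i z := by
      have hiF : i₀ ∈ F := by
        by_contra h
        exact zero_ne_one (hGp.symm.trans (hF1 i₀ h))
      filter_upwards [hF] with z hz
      rw [hz, Finset.mul_prod_erase F (fun i => G i z) hiF]
    refine ⟨fun z => n i₀ z * ∏ i ∈ F.erase i₀, G i z, ?_, ?_, ?_⟩
    · exact (hns i₀).self_of_nhds.mul (contDiffAt_prod fun i _ => (hGs i).contDiffAt
        (hW.mem_nhds (hZW hp)))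
    · refine mul_ne_zero (hn0 i₀) (Finset.prod_ne_zero_iff.2 fun i hi h => ?_)
      refine (Finset.mem_erase.1 hi).1 (Subtype.ext ?_)
      exact (hG0 i p (hZW hp) h).symm
    · filter_upwards [hall, hGn i₀] with z h1 h2
      rw [h1, h2]
      ring

/-- Equidimensional Sard: the critical values form a null set, which cannot be the whole plane. -/
theorem exists_regular_value {τ : ℂ → ℂ} {O : Set ℂ} (hO : IsOpen O) (hτ : ContDiffOn ℝ ∞ τ O) :
    ∃ t, ∀ z ∈ O, τ z = t → (fderiv ℝ τ z).det ≠ 0 := by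
  by_contra! h
  have hnull := addHaar_image_eq_zero_of_det_fderivWithin_eq_zero (volume : Measure ℂ)
    (s := {z ∈ O | (fderiv ℝ τ z).det = 0}) (f := τ) (f' := fderiv ℝ τ)
    (fun z hz => (hτ.differentiableAt_real hO hz.1).hasFDerivAt.hasFDerivWithinAt) fun z hz => hz.2
  have huniv : τ '' {z ∈ O | (fderiv ℝ τ z).det = 0} = univ := by
    refine eq_univ_of_forall fun t => ?_
    obtain ⟨z, hz, hzt, hdet⟩ := h t
    exact ⟨z, ⟨hz, hdet⟩, hzt⟩
  rw [huniv] at hnull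
  exact Measure.measure_univ_ne_zero.2 (NeZero.ne _) hnull

/-- The image line bundle of a smooth family of rank one matrices has a nowhere vanishing smooth
section. -/
theorem exists_smooth_section (hW : IsOpen W) {a b c d : ℂ → ℂ} (ha : ContDiffOn ℝ ∞ a W)
    (hb : ContDiffOn ℝ ∞ b W) (hc : ContDiffOn ℝ ∞ c W) (hd : ContDiffOn ℝ ∞ d W)
    (hdet : ∀ z ∈ W, a z * b z = c z * d z)
    (hne : ∀ z ∈ W, (a z ≠ 0 ∨ c z ≠ 0) ∨ (d z ≠ 0 ∨ b z ≠ 0)) :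
    ∃ v₁ v₂ : ℂ → ℂ, ContDiffOn ℝ ∞ v₁ W ∧ ContDiffOn ℝ ∞ v₂ W ∧
      (∀ z ∈ W, v₁ z ≠ 0 ∨ v₂ z ≠ 0) ∧
      ∀ z ∈ W, a z * v₂ z = c z * v₁ z ∧ d z * v₂ z = b z * v₁ z := by
  set O : Set ℂ := {z ∈ W | d z ≠ 0 ∨ b z ≠ 0} with hO
  have hOW : O ⊆ W := fun z hz => hz.1
  have hOo : IsOpen O := by
    have h1 := hd.continuousOn.isOpen_inter_preimage hW isOpen_compl_singleton (t := {(0 : ℂ)}ᶜ)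
    have h2 := hb.continuousOn.isOpen_inter_preimage hW isOpen_compl_singleton (t := {(0 : ℂ)}ᶜ)
    convert! h1.union h2 using 1
    ext z
    simp [hO]
  -- Where the row `(d, b)` is nonzero, `-τ` is the coefficient expressing `(a, c)` as a multiple of
  -- it.
  set τ : ℂ → ℂ := fun z => -(a z * conj (d z) + c z * conj (b z)) /
    (conj (d z) * d z + conj (b z) * b z) with hτ
  have hτs : ContDiffOn ℝ ∞ τ O :=
    ContDiffOn.div_complex
      (((ha.mono hOW).mul (hd.mono hOW).complexConj).add
        ((hc.mono hOW).mul (hb.mono hOW).complexConj)).neg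
      (((hd.mono hOW).complexConj.mul (hd.mono hOW)).add
        ((hb.mono hOW).complexConj.mul (hb.mono hOW)))
      fun z hz => conj_mul_self_add_ne_zero hz.2
  have hτa : ∀ z ∈ O, a z = -τ z * d z ∧ c z = -τ z * b z := by
    intro z hz
    have h0 := conj_mul_self_add_ne_zero hz.2
    have h1 : τ z * (conj (d z) * d z + conj (b z) * b z)
        = -(a z * conj (d z) + c z * conj (b z)) := div_mul_cancel₀ _ h0
    have h2 := hdet z hz.1
    constructor
    · apply mul_right_cancel₀ h0
      linear_combination d z * h1 + conj (b z) * h2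
    · apply mul_right_cancel₀ h0
      linear_combination b z * h1 - conj (d z) * h2
  obtain ⟨t, ht⟩ := exists_regular_value hOo hτs
  set q : ℂ → ℂ := fun z => τ z - t with hq
  set Z : Set ℂ := {z ∈ O | τ z = t} with hZ
  have hZW : Z ⊆ W := fun z hz => hz.1.1
  have hqZ : ∀ p ∈ Z, (∀ᶠ z in 𝓝 p, ContDiffAt ℝ ∞ q z) ∧ q p = 0 ∧ (fderiv ℝ q p).det ≠ 0 := by
    rintro p ⟨hpO, hpt⟩
    refine ⟨?_, by simp [hq, hpt], ?_⟩
    · filter_upwards [hOo.mem_nhds hpO] with z hz using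
        (hτs.contDiffAt (hOo.mem_nhds hz)).sub contDiffAt_const
    · rw [hq, fderiv_sub_const]
      exact ht p hpO hpt
  -- The section `-(a, c) - t (d, b)` equals `(τ - t) (d, b)` on `O`, so for a regular value `t` its
  -- zeros are nondegenerate; off `O` it is `-(a, c)`, which is nonzero there.
  set s₁ : ℂ → ℂ := fun z => -a z - t * d z with hs₁
  set s₂ : ℂ → ℂ := fun z => -c z - t * b z with hs₂
  have hs₁s : ContDiffOn ℝ ∞ s₁ W := ha.neg.sub (contDiffOn_const.mul hd)
  have hs₂s : ContDiffOn ℝ ∞ s₂ W := hc.neg.sub (contDiffOn_const.mul hb)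
  have hsO : ∀ z ∈ O, s₁ z = q z * d z ∧ s₂ z = q z * b z := by
    intro z hz
    obtain ⟨h1, h2⟩ := hτa z hz
    simp only [hs₁, hs₂, hq]
    constructor
    · linear_combination -h1
    · linear_combination -h2
  have hsZ : ∀ z ∈ W, z ∉ Z → s₁ z ≠ 0 ∨ s₂ z ≠ 0 := by
    intro z hz hzZ
    by_cases hzO : z ∈ O
    · have hq0 : q z ≠ 0 := fun h => hzZ ⟨hzO, sub_eq_zero.1 h⟩
      rw [(hsO z hzO).1, (hsO z hzO).2]
      exact hzO.2.imp (mul_ne_zero hq0) (mul_ne_zero hq0)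
    · have h1 : ¬ (d z ≠ 0 ∨ b z ≠ 0) := fun h => hzO ⟨hz, h⟩
      have h2 := (hne z hz).resolve_right h1
      push Not at h1
      simpa [hs₁, hs₂, h1.1, h1.2] using h2
  -- At a point of `Z` the invertible differential isolates the zero. At any other point, including
  -- those of `W` outside `O`, the section is nonzero nearby whereas it vanishes on `Z`.
  have hZloc : ∀ p ∈ W, ∃ N ∈ 𝓝 p, N ∩ Z ⊆ {p} := by
    intro p hp
    by_cases hpZ : p ∈ Z
    · obtain ⟨h1, h2, h3⟩ := hqZ p hpZ
      have hqd : DifferentiableAt ℝ q p := h1.self_of_nhds.differentiableAt (by simp)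
      have hev : ∀ᶠ z in 𝓝[≠] p, q z ≠ 0 := by
        set e := (fderiv ℝ q p).toContinuousLinearEquivOfDetNeZero h3
        exact hqd.hasFDerivAt.eventually_ne
          ⟨_, e.antilipschitz⟩
      rw [eventually_nhdsWithin_iff] at hev
      refine ⟨_, hev, fun z hz => ?_⟩
      by_contra hzp
      exact hz.1 hzp (by simp [hq, hz.2.2])
    · have hev : ∀ᶠ z in 𝓝 p, s₁ z ≠ 0 ∨ s₂ z ≠ 0 := by
        rcases hsZ p hp hpZ with h | h
        · exact ((hs₁s.differentiableAt_real hW hp).continuousAt.eventually_ne h).mono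
            fun z => Or.inl
        · exact ((hs₂s.differentiableAt_real hW hp).continuousAt.eventually_ne h).mono
            fun z => Or.inr
      refine ⟨_, hev, fun z hz => ?_⟩
      exfalso
      have h1 := hsO z hz.2.1
      have h2 : q z = 0 := by simp [hq, hz.2.2]
      have h3 : s₁ z ≠ 0 ∨ s₂ z ≠ 0 := hz.1
      simp [h1, h2] at h3
  obtain ⟨G, hGs, hG0, hGZ⟩ := exists_function_with_zeros hW hZW hZloc hqZ
  have hGne : ∀ p ∈ W, ∀ᶠ z in 𝓝[≠] p, G z ≠ 0 := by
    intro p hp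
    obtain ⟨N, hN, hNZ⟩ := hZloc p hp
    rw [eventually_nhdsWithin_iff]
    filter_upwards [hN, hW.mem_nhds hp] with z h1 h2 hzp h0
    exact hzp (hNZ ⟨h1, hG0 z h2 h0⟩)
  obtain ⟨v₁, v₂, hv₁, hv₂, hv, hsv⟩ := exists_quotient (s₁ := s₁) (s₂ := s₂) hGne (fun p hp => by
    by_cases hpZ : p ∈ Z
    · obtain ⟨n, hn, hn0, hGn⟩ := hGZ p hpZ
      refine ⟨fun z => d z * (n z)⁻¹, fun z => b z * (n z)⁻¹,
        (hd.contDiffAt (hW.mem_nhds hp)).mul (hn.inv hn0),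
        (hb.contDiffAt (hW.mem_nhds hp)).mul (hn.inv hn0), ?_, ?_⟩
      · exact hpZ.1.2.imp (fun h => mul_ne_zero h (inv_ne_zero hn0))
          fun h => mul_ne_zero h (inv_ne_zero hn0)
      · filter_upwards [hGn, hOo.mem_nhds hpZ.1, hn.continuousAt.eventually_ne hn0] with z h1 h2 h3
        rw [h1, (hsO z h2).1, (hsO z h2).2]
        constructor <;> field_simp
    · have hGp : G p ≠ 0 := fun h => hpZ (hG0 p hp h)
      have hGc := hGs.contDiffAt (hW.mem_nhds hp)
      refine ⟨fun z => s₁ z * (G z)⁻¹, fun z => s₂ z * (G z)⁻¹,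
        (hs₁s.contDiffAt (hW.mem_nhds hp)).mul (hGc.inv hGp),
        (hs₂s.contDiffAt (hW.mem_nhds hp)).mul (hGc.inv hGp), ?_, ?_⟩
      · exact (hsZ p hp hpZ).imp (fun h => mul_ne_zero h (inv_ne_zero hGp))
          fun h => mul_ne_zero h (inv_ne_zero hGp)
      · filter_upwards [hGc.continuousAt.eventually_ne hGp] with z h
        constructor <;> field_simp) hW
  refine ⟨v₁, v₂, hv₁, hv₂, hv, fun p hp => ?_⟩
  -- The proportionality relations are first obtained multiplied by `G`, then divided by it using
  -- continuity across its isolated zeros.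
  have hlim : ∀ f : ℂ → ℂ, ContDiffOn ℝ ∞ f W → (∀ z ∈ W, G z * f z = 0) → f p = 0 := by
    intro f hf h
    have h1 : ContinuousAt f p := (hf.differentiableAt_real hW hp).continuousAt
    refine tendsto_nhds_unique (h1.tendsto.mono_left nhdsWithin_le_nhds)
      (tendsto_const_nhds.congr' ?_ : Tendsto f (𝓝[≠] p) (𝓝 0))
    filter_upwards [hGne p hp, nhdsWithin_le_nhds (hW.mem_nhds hp)] with z h2 h3
    exact ((mul_eq_zero.1 (h z h3)).resolve_left h2).symm
  constructor
  · refine sub_eq_zero.1 (hlim (fun z => a z * v₂ z - c z * v₁ z) ((ha.mul hv₂).sub (hc.mul hv₁))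
      fun z hz => ?_)
    obtain ⟨h1, h2⟩ := hsv z hz
    simp only [hs₁, hs₂] at h1 h2
    linear_combination c z * h1 - a z * h2 - t * hdet z hz
  · refine sub_eq_zero.1 (hlim (fun z => d z * v₂ z - b z * v₁ z) ((hd.mul hv₂).sub (hb.mul hv₁))
      fun z hz => ?_)
    obtain ⟨h1, h2⟩ := hsv z hz
    simp only [hs₁, hs₂] at h1 h2
    linear_combination b z * h1 - d z * h2 + hdet z hz

end GlobalFrame

/-! ### Existence of a representation over the whole of `W`. -/

section Existence

variable {r : ℂ → EuclideanSpace ℝ (Fin 4)} {W : Set ℂ}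

/-- The matrix with rows `(a, c)` and `(d, b)` has rank one: `ab - cd` is minus the sum of the
squares `(∂xᵏ)²`, and the entries determine all the `∂xᵏ`. Its row-space section, suitably rescaled,
is the column factor of the required frame. -/
theorem IsConformalImmersionOn.exists_represents (hr : IsConformalImmersionOn r W)
    (hW : IsOpen W) : ∃ R : WeierstrassData, R.Represents r W := by
  set f : Fin 4 → ℂ → ℂ := fun k => wirtingerD (fun w => ((r w k : ℝ) : ℂ)) with hf
  have hfs : ∀ k, ContDiffOn ℝ ∞ (f k) W := fun k =>
    (Complex.ofRealCLM.contDiff.comp_contDiffOn (contDiffOn_coord hr.smooth k)).wirtingerD hW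
  set a : ℂ → ℂ := fun z => f 1 z - Complex.I * f 0 z with ha
  set b : ℂ → ℂ := fun z => -f 1 z - Complex.I * f 0 z with hb
  set c : ℂ → ℂ := fun z => f 2 z - Complex.I * f 3 z with hc
  set d : ℂ → ℂ := fun z => f 2 z + Complex.I * f 3 z with hd
  have has : ContDiffOn ℝ ∞ a W := (hfs 1).sub (contDiffOn_const.mul (hfs 0))
  have hbs : ContDiffOn ℝ ∞ b W := (hfs 1).neg.sub (contDiffOn_const.mul (hfs 0))
  have hcs : ContDiffOn ℝ ∞ c W := (hfs 2).sub (contDiffOn_const.mul (hfs 3))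
  have hds : ContDiffOn ℝ ∞ d W := (hfs 2).add (contDiffOn_const.mul (hfs 3))
  have hdet : ∀ z ∈ W, a z * b z = c z * d z := by
    intro z hz
    have := hr.conformal z hz
    rw [Fin.sum_univ_four] at this
    change f 0 z ^ 2 + f 1 z ^ 2 + f 2 z ^ 2 + f 3 z ^ 2 = 0 at this
    simp only [ha, hb, hc, hd]
    linear_combination -this + (f 0 z ^ 2 + f 3 z ^ 2) * Complex.I_mul_I
  have hne : ∀ z ∈ W, (a z ≠ 0 ∨ c z ≠ 0) ∨ (d z ≠ 0 ∨ b z ≠ 0) := by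
    intro z hz
    by_contra! h
    obtain ⟨⟨h1, h2⟩, h3, h4⟩ := h
    obtain ⟨k, hk⟩ := exists_wirtingerD_ne_zero hW hr hz
    simp only [ha, hb, hc, hd] at h1 h2 h3 h4
    have hI := Complex.I_mul_I
    apply hk
    change f k z = 0
    fin_cases k
    · change f 0 z = 0
      linear_combination Complex.I / 2 * h1 + Complex.I / 2 * h4 + f 0 z * hI
    · change f 1 z = 0
      linear_combination 1 / 2 * h1 - 1 / 2 * h4
    · change f 2 z = 0
      linear_combination 1 / 2 * h2 + 1 / 2 * h3
    · change f 3 z = 0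
      linear_combination Complex.I / 2 * h2 - Complex.I / 2 * h3 + f 3 z * hI
  obtain ⟨v₁, v₂, hv₁, hv₂, hv0, hav⟩ := exists_smooth_section hW has hbs hcs hds hdet hne
  have hn : ∀ z ∈ W, conj (v₁ z) * v₁ z + conj (v₂ z) * v₂ z ≠ 0 := fun z hz =>
    conj_mul_self_add_ne_zero (hv0 z hz)
  -- This value of `∂̄h` makes `∂̄(e^h v)` orthogonal to `v`.
  obtain ⟨h, hhs, hh⟩ := exists_wirtingerDbar_eq hW
    (g := fun z => -(conj (v₁ z) * wirtingerDbar v₁ z + conj (v₂ z) * wirtingerDbar v₂ z) /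
      (conj (v₁ z) * v₁ z + conj (v₂ z) * v₂ z))
    (ContDiffOn.div_complex ((hv₁.complexConj.mul (hv₁.wirtingerDbar hW)).add
      (hv₂.complexConj.mul (hv₂.wirtingerDbar hW))).neg
      ((hv₁.complexConj.mul hv₁).add (hv₂.complexConj.mul hv₂)) hn)
  have he : ContDiffOn ℝ ∞ (fun z => Complex.exp (h z)) W := hhs.cexp_real
  set w₁ : ℂ → ℂ := fun z => Complex.exp (h z) * v₁ z with hw₁
  set w₂ : ℂ → ℂ := fun z => Complex.exp (h z) * v₂ z with hw₂
  have hw₁s : ContDiffOn ℝ ∞ w₁ W := he.mul hv₁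
  have hw₂s : ContDiffOn ℝ ∞ w₂ W := he.mul hv₂
  have hw0 : ∀ z ∈ W, w₁ z ≠ 0 ∨ w₂ z ≠ 0 := fun z hz =>
    (hv0 z hz).imp (mul_ne_zero (Complex.exp_ne_zero _)) (mul_ne_zero (Complex.exp_ne_zero _))
  have hwn : ∀ z ∈ W, conj (w₁ z) * w₁ z + conj (w₂ z) * w₂ z ≠ 0 := fun z hz =>
    conj_mul_self_add_ne_zero (hw0 z hz)
  have haw : ∀ z ∈ W, a z * w₂ z = c z * w₁ z ∧ d z * w₂ z = b z * w₁ z := by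
    intro z hz
    obtain ⟨h1, h2⟩ := hav z hz
    simp only [hw₁, hw₂]
    constructor
    · linear_combination Complex.exp (h z) * h1
    · linear_combination Complex.exp (h z) * h2
  -- Each row is a multiple of `(w₁, w₂)`; projection onto `w` reads off the multiplier smoothly.
  set u₁ : ℂ → ℂ := fun z => (a z * conj (w₁ z) + c z * conj (w₂ z)) /
    (conj (w₁ z) * w₁ z + conj (w₂ z) * w₂ z) with hu₁
  set u₂ : ℂ → ℂ := fun z => (d z * conj (w₁ z) + b z * conj (w₂ z)) /
    (conj (w₁ z) * w₁ z + conj (w₂ z) * w₂ z) with hu₂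
  have hws := (hw₁s.complexConj.mul hw₁s).add (hw₂s.complexConj.mul hw₂s)
  have hu₁s : ContDiffOn ℝ ∞ u₁ W :=
    ((has.mul hw₁s.complexConj).add (hcs.mul hw₂s.complexConj)).div_complex hws hwn
  have hu₂s : ContDiffOn ℝ ∞ u₂ W :=
    ((hds.mul hw₁s.complexConj).add (hbs.mul hw₂s.complexConj)).div_complex hws hwn
  have hprod : ∀ z ∈ W, (u₁ z * w₁ z = a z ∧ u₁ z * w₂ z = c z) ∧
      (u₂ z * w₁ z = d z ∧ u₂ z * w₂ z = b z) := by
    intro z hz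
    obtain ⟨h1, h2⟩ := haw z hz
    have h0 := hwn z hz
    simp only [hu₁, hu₂, div_mul_eq_mul_div, div_eq_iff h0]
    refine ⟨⟨?_, ?_⟩, ?_, ?_⟩
    · linear_combination -conj (w₂ z) * h1
    · linear_combination conj (w₁ z) * h1
    · linear_combination -conj (w₂ z) * h2
    · linear_combination conj (w₁ z) * h2
  refine exists_represents_of_frame hW hr.smooth hw₁s hw₂s hu₁s hu₂s hw0 (fun z hz => ?_)
    (fun z hz => ?_) (f := f) (fun _ => rfl) (fun z hz => (hprod z hz).1.1)
    (fun z hz => (hprod z hz).2.2) (fun z hz => (hprod z hz).1.2) fun z hz => (hprod z hz).2.1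
  · by_contra! h0
    have h1 := hprod z hz
    rw [h0.1, h0.2] at h1
    have h2 := hne z hz
    simp [← h1.1.1, ← h1.1.2, ← h1.2.1, ← h1.2.2] at h2
  · have hhd := hhs.differentiableAt_real hW hz
    have hed := he.differentiableAt_real hW hz
    rw [wirtingerDbar_mul hed (hv₁.differentiableAt_real hW hz),
      wirtingerDbar_mul hed (hv₂.differentiableAt_real hW hz), wirtingerDbar_cexp hhd, hh z hz]
    have h0 := hn z hz
    simp only [hw₁, hw₂, map_mul]
    field_simp
    ring

end Existence

/-! ### The corollary, with the pole of `h` at a boundary point of `V` inside `W`. -/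

theorem mainTheorem3 (W V : Set ℂ) (hW : IsOpen W)
    (r : ℂ → EuclideanSpace ℝ (Fin 4)) (hr : IsConformalImmersionOn r W)
    (hV : IsOpen V) (hVconn : IsConnected V) (hVW : V ⊂ W)
    (hcomp : ∀ z ∈ V, connectedComponentIn W z ≠ V) :
    (∃ R : WeierstrassData, R.Represents r W) ∧
    ∃ h : ℂ → ℂ, DifferentiableOn ℂ h V ∧ ¬ ContinuesAnalyticallyTo h V W ∧
      ∀ R : WeierstrassData, R.Represents r W →
        (R.gauge h).Represents r V ∧ ¬ (R.gauge h).ExtendsTo r V W := by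
  obtain ⟨p, hpW, hp, hpV⟩ := exists_mem_closure_notMem hV hVconn hVW.subset hcomp
  have hh : DifferentiableOn ℂ (fun z => (z - p)⁻¹) V :=
    DifferentiableOn.inv (by fun_prop) fun z hz => sub_ne_zero.2 fun h => hpV (h ▸ hz)
  exact ⟨hr.exists_represents hW, fun z => (z - p)⁻¹, hh,
    not_continuesAnalyticallyTo_inv hW hpW hp hpV, fun R hR =>
      ⟨hR.gauge hVW.subset hV hh, not_extendsTo_gauge_inv hW hr hV hVW.subset hpW hp hpV hR⟩⟩
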